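/- Let $I=(c,d)\subset\mathbb R$ be an open interval, $-\infty\le c<d\le\infty$, and let $L^0(I)$ be the space of classes (modulo equality a.e. for Lebesgue measure) of measurable functions $I\to[-\infty,\infty]$. Let $v:I\to[-\infty,\infty]$ be measurable with $v>0$ a.e. on $I$, $\int_c^x|v|<\infty$ for every $x\in I$, and $\lim_{b\to d-}\int_c^b v=\infty$, and put $w(x)=\big[\int_c^x v\big]^{-1}\in(0,\infty)$, $x\in I$. For $f\in L^0(I)$ with $\int_c^x|f|<\infty$ for all $x\in I$ set $$\|f\|_{Ces^\wedge_\infty}=\operatorname*{ess\,sup}_{x\in I}\Big|w(x)\int_c^x f\Big|,\qquad \|f\|_{Ces_\infty}=\operatorname*{ess\,sup}_{x\in I}\,w(x)\int_c^x |f|,$$ and let $Ces_\infty$ be the set of all such $f$ with $\|f\|_{Ces_\infty}<\infty$. Let $(Ces_\infty,\|\cdot\|_{Ces^\wedge_\infty})'_{\mathrm w}$ be the set of all $g\in L^0(I)$ such that $fg\in L^1(I)$ for all $f\in Ces_\infty$ and $$\|g\|_{(Ces_\infty,\|\cdot\|_{Ces^\wedge_\infty})'_{\mathrm w}}:=\sup_{0\ne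 h\in Ces_\infty}\frac{\left|\int_I hg\right|}{\|h\|_{Ces^\wedge_\infty}}<\infty.$$ Let $BPV(I)$ be the set of functions $I\to\mathbb R$ of bounded pointwise variation on $I$. For $u\in BPV(I)$ let $\lambda_u$ be the unique real Borel measure on $I$ with $\lambda_u((a,b])=u(b+)-u(a+)$ for all $a\le b$ in $I$, and let $\|\lambda_u\|=|\lambda_u|(I)$ be its total variation. Theorem. For every $g\in L^0(I)$ the following are equivalent: (i) $g\in(Ces_\infty,\|\cdot\|_{Ces^\wedge_\infty})'_{\mathrm w}$; (ii) $vg\in L^1(I)$; some function in $BPV(I)$ equals $g/w$ a.e. on $I$; and $\int_I v(t)\,\|g\|_{L^\infty([t,d))}\,dt<\infty$. Moreover, there are absolute constants $A,B>0$ (independent of $I$, $v$ and $g$) such that, whenever (i) holds, every $\tilde g\in BPV(I)$ with $\tilde g=g/w$ a.e. satisfies $$A\big(\|vg\|_{L^1(I)}+\|\lambda_{\tilde g}\|\big)\le\|g\|_{(Ces_\infty,\|\cdot\|_{Ces^\wedge_\infty})'_{\mathrm w}}\le B\big(\|vg\|_{L^1(I)}+\|\lambda_{\tilde g}\|\big).$$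 -/

import Mathlib

open MeasureTheory Filter Set
open scoped ENNReal NNReal Topology

noncomputable section

namespace CesaroSpace

/-- The open interval `I = (c, d) ⊆ ℝ`; the endpoints may be infinite. -/
def interval (c d : EReal) : Set ℝ := {x : ℝ | c < (x : EReal) ∧ (x : EReal) < d}

instance instOrdConnectedInterval (c d : EReal) : OrdConnected (interval c d) :=
  ⟨fun _ hx _ hy _ hz =>
    ⟨hx.1.trans_le (EReal.coe_le_coe_iff.2 hz.1), (EReal.coe_le_coe_iff.2 hz.2).trans_lt hy.2⟩⟩

instance instCompactIccSpaceInterval (c d : EReal) : CompactIccSpace (interval c d) where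
  isCompact_Icc := by
    intro a b
    rw [Subtype.isCompact_iff]
    have h : ((↑) : interval c d → ℝ) '' Icc a b = Icc (a : ℝ) (b : ℝ) := by
      ext x
      constructor
      · rintro ⟨y, hy, rfl⟩
        exact ⟨hy.1, hy.2⟩
      · intro hx
        exact ⟨⟨x, (instOrdConnectedInterval c d).out a.2 b.2 hx⟩, ⟨hx.1, hx.2⟩, rfl⟩
    rw [h]
    exact isCompact_Icc

/-- Lebesgue measure on `I`. -/
instance instMeasureSpaceInterval (c d : EReal) : MeasureSpace (interval c d) :=
  Measure.Subtype.measureSpace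

/-- `L⁰(I)`: classes, modulo equality a.e. with respect to Lebesgue measure, of measurable
functions `I → [-∞, ∞]`. -/
abbrev L0 (c d : EReal) : Type := interval c d →ₘ[(volume : Measure (interval c d))] EReal

/-- `‖f‖_{L¹(I)}`, possibly infinite. -/
def l1Norm {c d : EReal} (f : interval c d → EReal) : ℝ≥0∞ := ∫⁻ x, (f x).abs

/-- `∫_c^x f`, used when `f` is integrable over `(c, x)` (hence finite a.e. there). -/
def primitive {c d : EReal} (f : interval c d → EReal) (x : interval c d) : ℝ :=
  ∫ t in Iio x, (f t).toReal

/-- `f ∈ L¹_loc([c, d))`, that is, `∫_c^x |f| < ∞` for all `x ∈ I`. -/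
def LocallyL1 {c d : EReal} (f : interval c d → EReal) : Prop :=
  ∀ x : interval c d, ∫⁻ t in Iio x, (f t).abs < ∞

/-- The standing assumption on the weight: `w(x) = (∫_c^x v)⁻¹ ∈ (0, ∞)` for all `x ∈ I`, where
`v` is measurable, `v ∈ L¹_loc([c, d))`, and `∫_c^b v → ∞` as `b → d-`. -/
structure IsWeight {c d : EReal} (v : interval c d → EReal) (w : interval c d → ℝ) : Prop where
  aemeasurable : AEMeasurable v volume
  locallyL1 : LocallyL1 v
  eq_inv : ∀ x, w x = (primitive v x)⁻¹
  pos : ∀ x, 0 < w x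
  tendsto : Tendsto (primitive v) atTop atTop

/-- `ρ(f) = ess sup_{x ∈ I} |w(x) ∫_c^x f|`. -/
def rho {c d : EReal} (w : interval c d → ℝ) (f : interval c d → EReal) : ℝ≥0∞ :=
  essSup (fun x => ‖w x * primitive f x‖ₑ) volume

/-- `‖f‖_{Ces_∞} = ρ(|f|)`. -/
def cesNorm {c d : EReal} (w : interval c d → ℝ) (f : L0 c d) : ℝ≥0∞ :=
  rho w (fun x => ((f x).abs : EReal))

/-- The altered norm `ρ(f)`. -/
def alteredNorm {c d : EReal} (w : interval c d → ℝ) (f : L0 c d) : ℝ≥0∞ :=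
  rho w f

/-- The weighted Cesàro space `Ces_∞`. -/
def Ces {c d : EReal} (w : interval c d → ℝ) : Set (L0 c d) :=
  {f | LocallyL1 f ∧ cesNorm w f < ∞}

/-- `sup { |∫_I h g| / ‖h‖ : h ∈ X, h ≠ 0 }`, for a space `X ⊆ L⁰(I)` with norm `N`. -/
def weakAssociateNorm {c d : EReal} (X : Set (L0 c d)) (N : L0 c d → ℝ≥0∞) (g : L0 c d) : ℝ≥0∞ :=
  ⨆ (h : L0 c d) (_ : h ∈ X) (_ : h ≠ 0), ‖∫ x, (h x * g x).toReal‖ₑ / N h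

/-- The weak associate space `(X, N)'_w`: all `g ∈ L⁰(I)` with `f g ∈ L¹(I)` for all `f ∈ X` and
with finite weak associate norm. -/
def weakAssociate {c d : EReal} (X : Set (L0 c d)) (N : L0 c d → ℝ≥0∞) : Set (L0 c d) :=
  {g | (∀ f ∈ X, l1Norm (fun x => f x * g x) < ∞) ∧ weakAssociateNorm X N g < ∞}

/-- `h ∈ (g / w) ∩ BPV(I)`: a function `h : I → ℝ` of bounded pointwise variation that equals
`g / w` a.e. -/
structure IsBPVRep {c d : EReal} (w : interval c d → ℝ) (g : L0 c d) (h : interval c d → ℝ) :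
    Prop where
  bpv : BoundedVariationOn h univ
  ae_eq : ∀ᵐ x, (h x : EReal) = (((w x)⁻¹ : ℝ) : EReal) * g x

/-- `‖λ_h‖ = |λ_h|(I)`, where `λ_h` is the real Borel measure on `I` with
`λ_h((a, b]) = h(b+) - h(a+)` for all `a ≤ b` in `I`. -/
def lambdaNorm {c d : EReal} {h : interval c d → ℝ} (hh : BoundedVariationOn h univ) : ℝ≥0∞ :=
  hh.vectorMeasure.variation univ

end CesaroSpace

end

/-!
Write `V = 1 / w` for the distribution function of `v dx`. It carries `v dx` to Lebesgue measure on
`(0, ∞)`, so tests of `g` against densities `(p ∘ V) v` become tests of `G`, where `G ∘ V = g`,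
against densities `p` on the half-line, and the altered norm of such a density is at most `1` when
`|∫_0^y p| ≤ y` for all `y > 0`.

*From the weak associate norm `N` to `g`.* Smearing point masses over short windows to their right
shows that `|∑ c_x G(x)| ≤ N` for finitely many right Lebesgue points `x` of `G`, as soon as the
distribution function of `∑ c_x δ_x` is bounded by the identity (`abs_linearCombination_le`). Three
choices of test give everything. Increments of `y G(y)` bound its variation by `2 N`
(`eVariationOn_mul_le`). Lebesgue measure, pushed to the right onto the points where the supremum of
`|G|` over `(y, ∞)` is nearly attained, bounds the integral of this decreasing majorant by `N`
(`lintegral_iSup_rightLebesguePoints_le`). The density `sign G` bounds `‖v g‖₁` by `N`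
(`lintegral_enorm_le`). A function with bounded variation on a set of full measure extends to one
in `BPV` (`exists_boundedVariationOn_extension`), and the total variation of its measure is at most
its variation on any dense set (`variation_vectorMeasure_univ_le`,
`eVariationOn_rightLim_le_of_dense`). So the lower bound holds with the constant `1 / 3`.

*From `g` to the weak associate norm.* For `f` in the Cesàro space the measure `|f| dx` is dominated
on initial rays by a multiple of `v dx`, hence integrates the decreasing majorant of `|g|`; this
gives `f g ∈ L¹` (`IsWeight.lintegral_abs_mul_tailSup_lt_top`). For the norm bound, let `û` be the
right limits of the representative of `g / w`, so that `g = û / V`. Approximating `g` by step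
functions on the cells `{j δ < V ≤ (j + 1) δ}` and summing by parts gives
`|∫ f g| ≤ ‖f‖ (‖λ‖ + ‖v g‖₁ + |û(d-)|)`, where `‖f‖` is the altered norm. The
majorant supplies the dominated convergence, and `û(d-) = 0` because
`v û / V` is integrable while `v / V` is not. So the upper bound holds with the constant `1`
(`IsWeight.weakAssociateNorm_le`).
-/

noncomputable section

namespace CesaroSpace

/-! ### Point evaluations on the half-line -/

/-- The sum of those coefficients of the finite combination `c` of point masses that sit in
`(-∞, y]`; this is the distribution function of `∑ c_x δ_x`. -/
def pointCdf (c : ℝ →₀ ℝ) (y : ℝ) : ℝ :=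
  Finsupp.linearCombination ℝ (fun x => (Ici x).indicator (1 : ℝ → ℝ) y) c

/-- The set of points `y > 0` at which the right averages of `G` converge to `G y`. -/
def rightLebesguePoints (G : ℝ → ℝ) : Set ℝ :=
  {y | 0 < y ∧ Tendsto (fun δ => δ⁻¹ * ∫ t in Ioc y (y + δ), G t) (𝓝[>] 0) (𝓝 (G y))}

lemma ae_mem_rightLebesguePoints {G : ℝ → ℝ} (hG : IntegrableOn G (Ioi 0)) :
    ∀ᵐ y ∂volume.restrict (Ioi 0), y ∈ rightLebesguePoints G := by
  have h0 : Integrable ((Ioi (0 : ℝ)).indicator G) :=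
    (integrable_indicator_iff measurableSet_Ioi).2 hG
  have := _root_.LocallyIntegrable.ae_hasDerivAt_integral h0.locallyIntegrable
  rw [ae_restrict_iff' measurableSet_Ioi]
  filter_upwards [this] with y hy hy0
  refine ⟨hy0, ?_⟩
  have h1 := (hy 0).tendsto_slope_zero_right
  rw [indicator_of_mem hy0] at h1
  refine h1.congr' ?_
  filter_upwards [self_mem_nhdsWithin] with δ hδ
  have hδ : 0 < δ := hδ
  have hy0 : 0 < y := hy0
  rw [smul_eq_mul, intervalIntegral.integral_interval_sub_left h0.intervalIntegrable
    h0.intervalIntegrable, intervalIntegral.integral_of_le (by linarith)]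
  congr 1
  refine setIntegral_congr_fun measurableSet_Ioc fun t ht => ?_
  exact indicator_of_mem (show (0 : ℝ) < t from hy0.trans ht.1) _

/-- The normalised indicator of a window `(x, x + δ]` has as primitive a ramp, which is the average
over the last `δ` units of the step function with jump at `x`. -/
lemma integral_window_eq {x y δ : ℝ} (hx : 0 < x) :
    ∫ t in Ioc 0 y, (Ioc x (x + δ)).indicator (1 : ℝ → ℝ) t =
      ∫ s in Ioc (y - δ) y, (Ici x).indicator (1 : ℝ → ℝ) s := by
  rw [integral_indicator_one measurableSet_Ioc, integral_indicator_one measurableSet_Ici,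
    measureReal_restrict_apply measurableSet_Ioc, measureReal_restrict_apply measurableSet_Ici]
  have h1 : Ioc x (x + δ) ∩ Ioc 0 y = Ioc x (min (x + δ) y) := by
    rw [Ioc_inter_Ioc, max_eq_left hx.le]
  have h2 : (Ici x ∩ Ioc (y - δ) y : Set ℝ) =ᵐ[volume] (Ioc (max x (y - δ)) y : Set ℝ) := by
    rw [← Ioi_inter_Iic (a := y - δ), ← inter_assoc, ← Ioi_inter_Iic, ← Ioi_inter_Ioi]
    exact ((Ioi_ae_eq_Ici.symm.inter (ae_eq_refl _))).inter (ae_eq_refl _)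
  rw [h1, measureReal_congr h2, Real.volume_real_Ioc, Real.volume_real_Ioc]
  congr 1
  rcases le_total (x + δ) y with h | h
  · rw [min_eq_left h, max_eq_right (by linarith)]; ring
  · rw [min_eq_right h, max_eq_left (by linarith)]

/-- If integration against `G` is bounded by `N` on every bounded measurable density whose
primitive is bounded by the identity, then the same bound holds for finite combinations of point
evaluations of `G`: smear each point mass over a short window to its right. -/
theorem abs_linearCombination_le {G : ℝ → ℝ} (hG : IntegrableOn G (Ioi 0)) {N : ℝ}
    (H : ∀ p : ℝ → ℝ, Measurable p → (∃ C, ∀ t, |p t| ≤ C) →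
      (∀ y > 0, |∫ t in Ioc 0 y, p t| ≤ y) → |∫ t in Ioi 0, p t * G t| ≤ N)
    (c : ℝ →₀ ℝ) (hc : ∀ x ∈ c.support, x ∈ rightLebesguePoints G)
    (hc' : ∀ y, 0 ≤ y → |pointCdf c y| ≤ y) :
    |Finsupp.linearCombination ℝ G c| ≤ N := by
  have hneg : ∀ y < 0, pointCdf c y = 0 := by
    intro y hy
    rw [pointCdf, Finsupp.linearCombination_apply, Finsupp.sum]
    refine Finset.sum_eq_zero fun x hx => ?_
    have := (hc x hx).1
    rw [indicator_of_notMem (by simp; linarith), smul_zero]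
  set p : ℝ → ℝ → ℝ := fun δ t =>
    ∑ x ∈ c.support, c x * (δ⁻¹ * (Ioc x (x + δ)).indicator (1 : ℝ → ℝ) t) with hp
  have hpm : ∀ δ, Measurable (p δ) := fun δ => by
    refine Finset.measurable_sum _ fun x _ => ?_
    exact ((measurable_one.indicator measurableSet_Ioc).const_mul _).const_mul _
  have hind : ∀ (s : Set ℝ) t, |s.indicator (1 : ℝ → ℝ) t| ≤ 1 := fun s t => by
    by_cases h : t ∈ s <;> simp [h]
  have hpb : ∀ δ, ∃ C, ∀ t, |p δ t| ≤ C := fun δ => by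
    refine ⟨∑ x ∈ c.support, |c x| * |δ⁻¹|, fun t => (Finset.abs_sum_le_sum_abs _ _).trans
      (Finset.sum_le_sum fun x _ => ?_)⟩
    rw [abs_mul, abs_mul]
    exact mul_le_mul_of_nonneg_left (mul_le_of_le_one_right (abs_nonneg _) (hind _ _))
      (abs_nonneg _)
  have hint : ∀ (δ : ℝ) (x : ℝ) (y : ℝ),
      Integrable (fun t => (Ioc x (x + δ)).indicator (1 : ℝ → ℝ) t) (volume.restrict (Ioc 0 y)) :=
    fun δ x y => (integrable_indicator_iff measurableSet_Ioc).2 (integrable_const _).integrableOn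
  have hpF : ∀ δ > 0, ∀ y > 0, |∫ t in Ioc 0 y, p δ t| ≤ y := by
    intro δ hδ y hy
    have h1 : ∫ t in Ioc 0 y, p δ t = δ⁻¹ * ∫ s in Ioc (y - δ) y, pointCdf c s := by
      simp only [hp, pointCdf, Finsupp.linearCombination_apply, Finsupp.sum, smul_eq_mul]
      rw [integral_finsetSum _ fun x _ => ((hint δ x y).const_mul _).const_mul _,
        integral_finsetSum, Finset.mul_sum]
      · refine Finset.sum_congr rfl fun x hx => ?_
        rw [integral_const_mul, integral_const_mul, integral_const_mul,
          integral_window_eq (hc x hx).1]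
        ring
      · intro x _
        exact Integrable.const_mul
          ((integrable_indicator_iff measurableSet_Ici).2 (integrable_const _).integrableOn) _
    have h2 : ‖∫ s in Ioc (y - δ) y, pointCdf c s‖ ≤ y * volume.real (Ioc (y - δ) y) := by
      refine norm_setIntegral_le_of_norm_le_const (by simp) fun s hs => ?_
      rcases lt_or_ge s 0 with h | h
      · simp [hneg s h, hy.le]
      · exact (hc' s h).trans hs.2
    rw [Real.volume_real_Ioc_of_le (by linarith), sub_sub_cancel, Real.norm_eq_abs] at h2
    rw [h1, abs_mul, abs_of_pos (inv_pos.2 hδ), inv_mul_le_iff₀ hδ]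
    linarith
  have hlim : Tendsto (fun δ => ∫ t in Ioi 0, p δ t * G t) (𝓝[>] 0)
      (𝓝 (Finsupp.linearCombination ℝ G c)) := by
    have h1 : ∀ δ, ∫ t in Ioi 0, p δ t * G t =
        ∑ x ∈ c.support, c x * (δ⁻¹ * ∫ t in Ioc x (x + δ), G t) := by
      intro δ
      have hi : ∀ x ∈ c.support, ∀ t, c x * (δ⁻¹ * (Ioc x (x + δ)).indicator (1 : ℝ → ℝ) t) * G t
          = c x * (δ⁻¹ * (Ioc x (x + δ)).indicator G t) := fun x _ t => by
        by_cases h : t ∈ Ioc x (x + δ) <;> simp [h, mul_assoc]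
      simp only [hp, Finset.sum_mul]
      rw [integral_finsetSum]
      · refine Finset.sum_congr rfl fun x hx => ?_
        rw [integral_congr_ae (ae_of_all _ (hi x hx)), integral_const_mul, integral_const_mul,
          integral_indicator measurableSet_Ioc, Measure.restrict_restrict measurableSet_Ioc,
          inter_eq_left.2]
        exact fun t ht => (hc x hx).1.trans ht.1
      · intro x hx
        rw [integrable_congr (ae_of_all _ (hi x hx))]
        exact ((hG.indicator measurableSet_Ioc).const_mul _).const_mul _
    simp only [h1, Finsupp.linearCombination_apply, Finsupp.sum, smul_eq_mul]
    exact tendsto_finsetSum _ fun x hx => (hc x hx).2.const_mul _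
  refine le_of_tendsto hlim.abs ?_
  filter_upwards [self_mem_nhdsWithin] with δ hδ
  exact H (p δ) (hpm δ) (hpb δ) (hpF δ hδ)

/-- A monotone sequence, stopped as soon as it exceeds `y`, has total variation at most `2 y`. -/
lemma sum_abs_stopped_le {u : ℕ → ℝ} (hu : Monotone u) (hu0 : ∀ i, 0 ≤ u i) {y : ℝ} (hy : 0 ≤ y)
    (n : ℕ) :
    ∑ i ∈ Finset.range n, |u (i + 1) * (Ici (u (i + 1))).indicator (1 : ℝ → ℝ) y -
      u i * (Ici (u i)).indicator (1 : ℝ → ℝ) y| ≤ if u n ≤ y then u n else 2 * y := by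
  induction n with
  | zero =>
    have := hu0 0
    split_ifs <;> simp <;> linarith
  | succ n ih =>
    rw [Finset.sum_range_succ]
    have h1 := hu n.le_succ
    have h2 := hu0 n
    simp only [indicator_apply, mem_Ici, Pi.one_apply, Nat.succ_eq_add_one] at *
    by_cases ha : u (n + 1) ≤ y
    · have hb : u n ≤ y := h1.trans ha
      simp only [ha, hb, if_true, mul_one] at ih ⊢
      rw [abs_of_nonneg (by linarith)]; linarith
    · by_cases hb : u n ≤ y
      · simp only [ha, hb, if_true, if_false, mul_one, mul_zero, zero_sub, abs_neg] at ih ⊢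
        rw [abs_of_nonneg h2]; linarith
      · simp only [ha, hb, if_false, mul_zero, sub_zero, abs_zero, add_zero] at ih ⊢
        exact ih

/-- Under the bound of `abs_linearCombination_le` the function `y ↦ y G(y)` has variation at most
`2 N` on the right Lebesgue points of `G`: its increments along a monotone sequence are tested
against the masses `± u_{i+1}` at `u_{i+1}` and `∓ u_i` at `u_i`. -/
theorem eVariationOn_mul_le {G : ℝ → ℝ} {N : ℝ}
    (H : ∀ c : ℝ →₀ ℝ, (∀ x ∈ c.support, x ∈ rightLebesguePoints G) →
      (∀ y, 0 ≤ y → |pointCdf c y| ≤ y) → |Finsupp.linearCombination ℝ G c| ≤ N) :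
    eVariationOn (fun y => y * G y) (rightLebesguePoints G) ≤ ENNReal.ofReal (2 * N) := by
  refine iSup_le fun ⟨n, u, hu, huE⟩ => ?_
  dsimp only
  set ε : ℕ → ℝ := fun i => (SignType.sign (u (i + 1) * G (u (i + 1)) - u i * G (u i)) : ℝ) with hε
  have hε1 : ∀ i, |ε i| ≤ 1 := fun i => by
    simp only [hε]
    cases SignType.sign (u (i + 1) * G (u (i + 1)) - u i * G (u i)) <;> simp
  have hu0 : ∀ i, 0 ≤ u i := fun i => (huE i).1.le
  -- the partial sums of the masses over `(-∞, y]` are bounded by `2 y`, hence the factor `1 / 2`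
  set c : ℝ →₀ ℝ := ∑ i ∈ Finset.range n, (ε i / 2) •
    (Finsupp.single (u (i + 1)) (u (i + 1)) - Finsupp.single (u i) (u i)) with hc
  have key := H c ?_ ?_
  · have h1 : Finsupp.linearCombination ℝ G c = (1 / 2) * ∑ i ∈ Finset.range n,
        |u (i + 1) * G (u (i + 1)) - u i * G (u i)| := by
      simp only [hc, map_sum, map_smul, map_sub, Finsupp.linearCombination_single, smul_eq_mul,
        Finset.mul_sum]
      refine Finset.sum_congr rfl fun i _ => ?_
      rw [← sign_mul_self (u (i + 1) * G (u (i + 1)) - u i * G (u i))]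
      simp only [hε]; ring
    rw [h1] at key
    have h2 := (le_abs_self _).trans key
    calc ∑ i ∈ Finset.range n, edist (u (i + 1) * G (u (i + 1))) (u i * G (u i))
        = ENNReal.ofReal (∑ i ∈ Finset.range n,
            |u (i + 1) * G (u (i + 1)) - u i * G (u i)|) := by
          rw [ENNReal.ofReal_sum_of_nonneg fun _ _ => abs_nonneg _]
          exact Finset.sum_congr rfl fun i _ => by rw [edist_dist, Real.dist_eq]
      _ ≤ _ := ENNReal.ofReal_le_ofReal (by linarith)
  · intro x hx
    have h1 := Finsupp.support_finsetSum hx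
    simp only [Finset.mem_biUnion] at h1
    obtain ⟨i, _, hi⟩ := h1
    have h2 := Finsupp.support_sub (Finsupp.support_smul hi)
    rcases Finset.mem_union.1 h2 with h | h
    · rw [Finset.mem_singleton.1 (Finsupp.support_single_subset h)]; exact huE _
    · rw [Finset.mem_singleton.1 (Finsupp.support_single_subset h)]; exact huE _
  · intro y hy
    have h1 : pointCdf c y = ∑ i ∈ Finset.range n, (ε i / 2) *
        (u (i + 1) * (Ici (u (i + 1))).indicator (1 : ℝ → ℝ) y -
          u i * (Ici (u i)).indicator (1 : ℝ → ℝ) y) := by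
      simp only [pointCdf, hc, map_sum, map_smul, map_sub, Finsupp.linearCombination_single,
        smul_eq_mul]
    have h2 := sum_abs_stopped_le hu hu0 hy n
    have h3 : (if u n ≤ y then u n else 2 * y) ≤ 2 * y := by split_ifs <;> linarith
    rw [h1]
    calc _ ≤ ∑ i ∈ Finset.range n, (1 / 2) *
        |u (i + 1) * (Ici (u (i + 1))).indicator (1 : ℝ → ℝ) y -
          u i * (Ici (u i)).indicator (1 : ℝ → ℝ) y| := by
          refine (Finset.abs_sum_le_sum_abs _ _).trans (Finset.sum_le_sum fun i _ => ?_)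
          rw [abs_mul]
          refine mul_le_mul_of_nonneg_right ?_ (abs_nonneg _)
          rw [abs_div, abs_two]; have := hε1 i; linarith
      _ ≤ y := by rw [← Finset.mul_sum]; linarith

/-- Testing against `p = sign G` bounds the `L¹` norm of `G`. -/
theorem lintegral_enorm_le {G : ℝ → ℝ} (hGm : Measurable G) (hG : IntegrableOn G (Ioi 0)) {N : ℝ}
    (H : ∀ p : ℝ → ℝ, Measurable p → (∃ C, ∀ t, |p t| ≤ C) →
      (∀ y > 0, |∫ t in Ioc 0 y, p t| ≤ y) → |∫ t in Ioi 0, p t * G t| ≤ N) :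
    ∫⁻ t in Ioi 0, ‖G t‖ₑ ≤ ENNReal.ofReal N := by
  set p : ℝ → ℝ := fun t => if 0 ≤ G t then 1 else -1 with hp
  have hpm : Measurable p :=
    Measurable.ite (measurableSet_le measurable_const hGm) measurable_const measurable_const
  have hp1 : ∀ t, |p t| ≤ 1 := fun t => by simp only [hp]; split_ifs <;> simp
  have hpG : ∀ t, p t * G t = ‖G t‖ := fun t => by
    simp only [hp, Real.norm_eq_abs]
    split_ifs with h
    · rw [abs_of_nonneg h, one_mul]
    · rw [abs_of_neg (not_le.1 h), neg_one_mul]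
  have h1 := H p hpm ⟨1, hp1⟩ fun y hy => by
    have := norm_setIntegral_le_of_norm_le_const (μ := volume) (s := Ioc 0 y) (C := 1) (f := p)
      (by simp) fun t _ => hp1 t
    rwa [Real.volume_real_Ioc_of_le hy.le, sub_zero, one_mul] at this
  simp only [hpG] at h1
  rw [← ofReal_integral_norm_eq_lintegral_enorm hG]
  exact ENNReal.ofReal_le_ofReal ((le_abs_self _).trans h1)

/-- For finitely many points the bound of `abs_linearCombination_le` controls the integral of the
decreasing step function `y ↦ max {|G (x i)| : y < x i}`. The set `A i` on which the maximum is
attained at the index `i` lies to the left of `x i`, and the masses `± |A i|` at the points `x i`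
are admissible because they arise by moving Lebesgue measure to the right. -/
theorem lintegral_iSup_range_le {G : ℝ → ℝ} {N : ℝ}
    (H : ∀ c : ℝ →₀ ℝ, (∀ x ∈ c.support, x ∈ rightLebesguePoints G) →
      (∀ y, 0 ≤ y → |pointCdf c y| ≤ y) → |Finsupp.linearCombination ℝ G c| ≤ N)
    {x : ℕ → ℝ} (hx : ∀ i, x i ∈ rightLebesguePoints G) (n : ℕ) :
    ∫⁻ y in Ioi 0, ⨆ i ∈ Finset.range n, (Iio (x i)).indicator (fun _ => ‖G (x i)‖ₑ) y ≤
      ENNReal.ofReal N := by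
  set a : ℕ → ℝ := fun i => |G (x i)| with ha
  set A : ℕ → Set ℝ := fun i => {y | 0 < y ∧ y < x i ∧
    ∀ j ∈ Finset.range n, y < x j → a j < a i ∨ (a j ≤ a i ∧ i ≤ j)} with hA
  have hAm : ∀ i, MeasurableSet (A i) := by
    intro i
    have : A i = Ioi 0 ∩ Iio (x i) ∩ ⋂ j ∈ Finset.range n,
        {y | y < x j → a j < a i ∨ (a j ≤ a i ∧ i ≤ j)} := by
      ext y; simp [hA, and_assoc]
    rw [this]
    refine (measurableSet_Ioi.inter measurableSet_Iio).inter
      (Finset.measurableSet_biInter _ fun j _ => ?_)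
    exact (measurableSet_Iio (a := x j)).imp (MeasurableSet.const _)
  have hAx : ∀ i, A i ⊆ Ioc 0 (x i) := fun i y hy => ⟨hy.1, hy.2.1.le⟩
  have hdisj : ∀ i ∈ Finset.range n, ∀ j ∈ Finset.range n, i ≠ j → Disjoint (A i) (A j) := by
    intro i hi j hj hij
    rw [Set.disjoint_left]
    rintro y ⟨_, h1, h2⟩ ⟨_, h3, h4⟩
    have h5 := h2 j hj h3
    have h6 := h4 i hi h1
    rcases h5 with h5 | h5 <;> rcases h6 with h6 | h6
    · linarith
    · linarith [h6.1]
    · linarith [h5.1]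
    · exact hij (le_antisymm h5.2 h6.2)
  set m : ℕ → ℝ := fun i => volume.real (A i) with hm
  have hfin : ∀ i, volume (A i) ≠ ∞ := fun i => ((measure_mono (hAx i)).trans_lt (by simp)).ne
  set c : ℝ →₀ ℝ := ∑ i ∈ Finset.range n, Finsupp.single (x i)
    ((SignType.sign (G (x i)) : ℝ) * m i) with hc
  have key := H c ?_ ?_
  · have h1 : Finsupp.linearCombination ℝ G c = ∑ i ∈ Finset.range n, m i * a i := by
      simp only [hc, map_sum, Finsupp.linearCombination_single, smul_eq_mul]
      refine Finset.sum_congr rfl fun i _ => ?_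
      simp only [ha]; rw [← sign_mul_self (G (x i))]; ring
    have h2 : ∫⁻ y in Ioi 0, ⨆ i ∈ Finset.range n, (Iio (x i)).indicator (fun _ => ‖G (x i)‖ₑ) y ≤
        ∫⁻ y, ∑ i ∈ Finset.range n, (A i).indicator (fun _ => ‖G (x i)‖ₑ) y := by
      rw [← lintegral_indicator measurableSet_Ioi]
      refine lintegral_mono fun y => ?_
      by_cases hy : y ∈ Ioi 0
      swap
      · simp [hy]
      rw [indicator_of_mem hy]
      refine iSup₂_le fun i hi => ?_
      by_cases hyi : y < x i
      swap
      · simp [hyi]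
      -- the index realising the maximum, the smallest one in case of a tie
      obtain ⟨k, hk, hkmax⟩ := ((Finset.range n).filter (y < x ·)).exists_max_image
        (fun j => toLex (a j, OrderDual.toDual j)) ⟨i, by simp [hyi, Finset.mem_range.1 hi]⟩
      rw [Finset.mem_filter] at hk
      have hyk : y ∈ A k := by
        refine ⟨hy, hk.2, fun j hj hyj => ?_⟩
        have := hkmax j (Finset.mem_filter.2 ⟨hj, hyj⟩)
        rw [Prod.Lex.toLex_le_toLex] at this
        rcases this with h | h
        · exact Or.inl h
        · exact Or.inr ⟨h.1.le, h.2⟩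
      calc (Iio (x i)).indicator (fun _ => ‖G (x i)‖ₑ) y ≤ ‖G (x k)‖ₑ := by
            rw [indicator_of_mem (show y ∈ Iio (x i) from hyi), ← ofReal_norm, ← ofReal_norm]
            refine ENNReal.ofReal_le_ofReal ?_
            rcases hyk.2.2 i hi hyi with h | h
            · exact h.le
            · exact h.1
        _ = (A k).indicator (fun _ => ‖G (x k)‖ₑ) y := by rw [indicator_of_mem hyk]
        _ ≤ _ := Finset.single_le_sum
            (f := fun i => (A i).indicator (fun _ => ‖G (x i)‖ₑ) y) (fun _ _ => zero_le) hk.1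
    refine h2.trans ?_
    rw [lintegral_finsetSum _ fun i _ => measurable_const.indicator (hAm i)]
    rw [h1] at key
    refine le_trans (le_of_eq ?_) (ENNReal.ofReal_le_ofReal ((le_abs_self _).trans key))
    rw [ENNReal.ofReal_sum_of_nonneg fun i _ => mul_nonneg measureReal_nonneg (abs_nonneg _)]
    refine Finset.sum_congr rfl fun i _ => ?_
    rw [lintegral_indicator_const (hAm i), mul_comm, ENNReal.ofReal_mul measureReal_nonneg,
      ofReal_measureReal (hfin i), ← Real.norm_eq_abs, ofReal_norm]
  · intro z hz
    have h1 := Finsupp.support_finsetSum hz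
    simp only [Finset.mem_biUnion] at h1
    obtain ⟨i, _, hi⟩ := h1
    rw [Finset.mem_singleton.1 (Finsupp.support_single_subset hi)]; exact hx i
  · intro y hy
    have h1 : pointCdf c y = ∑ i ∈ Finset.range n, (SignType.sign (G (x i)) : ℝ) * m i *
        (Ici (x i)).indicator (1 : ℝ → ℝ) y := by
      simp only [pointCdf, hc, map_sum, Finsupp.linearCombination_single, smul_eq_mul]
    rw [h1]
    calc _ ≤ ∑ i ∈ Finset.range n, m i * (Ici (x i)).indicator (1 : ℝ → ℝ) y := by
          refine (Finset.abs_sum_le_sum_abs _ _).trans (Finset.sum_le_sum fun i _ => ?_)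
          rw [mul_assoc, abs_mul]
          have h3 : 0 ≤ m i * (Ici (x i)).indicator (1 : ℝ → ℝ) y :=
            mul_nonneg measureReal_nonneg (indicator_nonneg (fun _ _ => zero_le_one) _)
          rw [abs_of_nonneg h3]
          refine mul_le_of_le_one_left h3 ?_
          cases SignType.sign (G (x i)) <;> simp
      _ = ∑ i ∈ (Finset.range n).filter (x · ≤ y), m i := by
          rw [Finset.sum_filter]
          refine Finset.sum_congr rfl fun i _ => ?_
          by_cases h : x i ≤ y <;> simp [h]
      _ = volume.real (⋃ i ∈ (Finset.range n).filter (x · ≤ y), A i) := by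
          rw [measureReal_biUnion_finset (fun i hi j hj hij => hdisj i (Finset.mem_filter.1 hi).1 j
            (Finset.mem_filter.1 hj).1 hij) (fun i _ => hAm i) (fun i _ => hfin i)]
      _ ≤ volume.real (Ioc 0 y) := by
          refine measureReal_mono (iUnion₂_subset fun i hi z hz => ?_) (by simp)
          exact ⟨hz.1, (hAx i hz).2.trans (Finset.mem_filter.1 hi).2⟩
      _ = y := by rw [Real.volume_real_Ioc_of_le hy, sub_zero]

/-- The least decreasing majorant of `|G|` over its right Lebesgue points is integrable on the
half-line, with integral at most `N`. -/
theorem lintegral_iSup_rightLebesguePoints_le {G : ℝ → ℝ} (hG : IntegrableOn G (Ioi 0)) {N : ℝ}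
    (H : ∀ c : ℝ →₀ ℝ, (∀ x ∈ c.support, x ∈ rightLebesguePoints G) →
      (∀ y, 0 ≤ y → |pointCdf c y| ≤ y) → |Finsupp.linearCombination ℝ G c| ≤ N) :
    ∫⁻ y in Ioi 0, ⨆ x ∈ rightLebesguePoints G, (Iio x).indicator (fun _ => ‖G x‖ₑ) y ≤
      ENNReal.ofReal N := by
  set E := rightLebesguePoints G
  -- a countable subset of `E` over which the graph of `G` is dense in the graph over `E`
  set Γ : Set (ℝ × ℝ) := (fun x => (x, G x)) '' E with hΓ
  have hEne : E.Nonempty := by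
    have h := ae_mem_rightLebesguePoints hG
    have : (ae (volume.restrict (Ioi (0 : ℝ)))).NeBot := by
      rw [ae_neBot]; intro h0
      have := congrArg (fun μ : Measure ℝ => μ univ) h0
      simp at this
    exact h.exists
  obtain ⟨q, hqE, hq⟩ : ∃ q : ℕ → ℝ, (∀ i, q i ∈ E) ∧
      ∀ x ∈ E, (x, G x) ∈ closure (range fun i => (q i, G (q i))) := by
    have : Nonempty Γ := (hEne.image _).to_subtype
    obtain ⟨u, hu⟩ := TopologicalSpace.exists_dense_seq Γ
    have h1 : ∀ i, ∃ x ∈ E, (x, G x) = (u i : ℝ × ℝ) := fun i => (u i).2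
    choose q hq1 hq2 using h1
    refine ⟨q, hq1, fun x hx => ?_⟩
    have h2 : (⟨(x, G x), mem_image_of_mem _ hx⟩ : Γ) ∈ closure (range u) := hu _
    rw [closure_subtype] at h2
    convert h2 using 2
    rw [← range_comp]
    exact congrArg range (funext hq2)
  have hle : ∀ y, (⨆ x ∈ E, (Iio x).indicator (fun _ => ‖G x‖ₑ) y) ≤
      ⨆ n, ⨆ i ∈ Finset.range n, (Iio (q i)).indicator (fun _ => ‖G (q i)‖ₑ) y := by
    intro y
    refine iSup₂_le fun x hx => ?_
    by_cases hyx : y < x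
    swap
    · simp [hyx]
    rw [indicator_of_mem (show y ∈ Iio x from hyx)]
    refine le_of_forall_lt fun b hb => ?_
    have hopen : IsOpen {z : ℝ × ℝ | y < z.1 ∧ b < ‖z.2‖ₑ} :=
      (isOpen_lt continuous_const continuous_fst).inter
        (isOpen_lt continuous_const (continuous_enorm.comp continuous_snd))
    obtain ⟨_, ⟨h1, h2⟩, ⟨i, rfl⟩⟩ := mem_closure_iff.1 (hq x hx) _ hopen ⟨hyx, hb⟩
    refine h2.trans_le ?_
    refine le_iSup_of_le (i + 1) (le_iSup₂_of_le i (by simp) ?_)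
    rw [indicator_of_mem (show y ∈ Iio (q i) from h1)]
  refine (lintegral_mono hle).trans ?_
  rw [lintegral_iSup]
  · exact iSup_le fun n => lintegral_iSup_range_le H hqE n
  · exact fun n => Measurable.iSup fun i => Measurable.iSup fun _ =>
      measurable_const.indicator measurableSet_Iio
  · intro n k hnk y
    exact biSup_mono fun i hi => Finset.range_mono hnk hi

/-! ### Functions of bounded variation and their measures -/

section BoundedVariation

variable {α : Type*} [LinearOrder α]

/-- A monotone function with bounded range has bounded variation. -/
lemma boundedVariationOn_of_monotone {p : α → ℝ} (hp : Monotone p) {C : ℝ} (hC : ∀ x, |p x| ≤ C) :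
    BoundedVariationOn p univ := by
  refine ne_top_of_le_ne_top (ENNReal.ofReal_ne_top (r := 2 * C)) (iSup_le fun ⟨n, u, hu, _⟩ => ?_)
  dsimp only
  calc ∑ i ∈ Finset.range n, edist (p (u (i + 1))) (p (u i))
      = ENNReal.ofReal (∑ i ∈ Finset.range n, (p (u (i + 1)) - p (u i))) := by
        have h0 : ∀ i, 0 ≤ p (u (i + 1)) - p (u i) := fun i => sub_nonneg.2 (hp (hu i.le_succ))
        rw [ENNReal.ofReal_sum_of_nonneg fun i _ => h0 i]
        exact Finset.sum_congr rfl fun i _ => by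
          rw [edist_dist, Real.dist_eq, abs_of_nonneg (h0 i)]
    _ ≤ _ := by
        rw [Finset.sum_range_sub (fun i => p (u i))]
        refine ENNReal.ofReal_le_ofReal ?_
        have h1 := abs_le.1 (hC (u n))
        have h2 := abs_le.1 (hC (u 0))
        linarith

/-- A real function of bounded variation on a set extends to one of bounded variation on the whole
order: extend the two monotone functions of its Jordan decomposition. -/
theorem exists_boundedVariationOn_extension {f : α → ℝ} {s : Set α} (hf : BoundedVariationOn f s) :
    ∃ h : α → ℝ, BoundedVariationOn h univ ∧ EqOn f h s := by
  rcases s.eq_empty_or_nonempty with rfl | ⟨a, ha⟩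
  · refine ⟨fun _ => 0, ?_, eqOn_empty _ _⟩
    have : eVariationOn (fun _ : α => (0 : ℝ)) univ = 0 :=
      eVariationOn.constant_on (by rintro _ ⟨x, -, rfl⟩ _ ⟨y, -, rfl⟩; rfl)
    simp [BoundedVariationOn, this]
  set W := variationOnFromTo f s a
  set K := (eVariationOn f s).toReal
  have hW : ∀ x, |W x| ≤ K := fun x => variationOnFromTo.abs_le_eVariationOn hf
  have hfb : ∀ x ∈ s, |f x| ≤ |f a| + K := fun x hx => by
    have h1 := hf.dist_le hx ha
    rw [Real.dist_eq] at h1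
    have h2 := abs_add_le (f x - f a) (f a)
    rw [sub_add_cancel] at h2
    linarith
  have hext : ∀ q : α → ℝ, MonotoneOn q s → (∀ x ∈ s, |q x| ≤ |f a| + 2 * K) →
      ∃ p : α → ℝ, BoundedVariationOn p univ ∧ EqOn q p s := by
    intro q hq hb
    obtain ⟨p, hp, hpq⟩ := hq.exists_monotone_extension
      ⟨-(|f a| + 2 * K), by rintro _ ⟨x, hx, rfl⟩; exact (abs_le.1 (hb x hx)).1⟩
      ⟨|f a| + 2 * K, by rintro _ ⟨x, hx, rfl⟩; exact (abs_le.1 (hb x hx)).2⟩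
    -- truncating the extension makes it bounded and does not change it on `s`
    set C := |f a| + 2 * K
    have hC : 0 ≤ C := (abs_nonneg _).trans (hb a ha)
    refine ⟨fun x => max (-C) (min C (p x)), boundedVariationOn_of_monotone (C := C) ?_ ?_, ?_⟩
    · exact fun x y hxy => max_le_max le_rfl (min_le_min le_rfl (hp hxy))
    · exact fun x => abs_le.2 ⟨le_max_left _ _, max_le (by linarith) (min_le_left _ _)⟩
    · intro x hx
      have h1 := abs_le.1 (hb x hx)
      dsimp only
      rw [← hpq hx, min_eq_right h1.2, max_eq_right h1.1]
  have hl := hf.locallyBoundedVariationOn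
  obtain ⟨p, hp, hpe⟩ := hext W (variationOnFromTo.monotoneOn hl ha)
    (fun x hx => by have := abs_nonneg (f a); have := (abs_nonneg _).trans (hW x); linarith [hW x])
  obtain ⟨q, hq, hqe⟩ := hext (fun x => W x - f x) (variationOnFromTo.sub_self_monotoneOn hl ha)
    (fun x hx => by have := abs_sub (W x) (f x); linarith [hW x, hfb x hx])
  refine ⟨fun x => p x - q x, ?_, fun x hx => ?_⟩
  · refine ne_top_of_le_ne_top (ENNReal.add_ne_top.2 ⟨hp, hq⟩) (iSup_le fun ⟨n, u, hu, hus⟩ => ?_)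
    dsimp only
    calc ∑ i ∈ Finset.range n, edist (p (u (i + 1)) - q (u (i + 1))) (p (u i) - q (u i))
        ≤ ∑ i ∈ Finset.range n, (edist (p (u (i + 1))) (p (u i)) +
            edist (q (u (i + 1))) (q (u i))) :=
          Finset.sum_le_sum fun i _ => by
            simpa only [sub_eq_add_neg, edist_neg_neg] using
              edist_add_add_le (p (u (i + 1))) (-q (u (i + 1))) (p (u i)) (-q (u i))
      _ ≤ _ := by
          rw [Finset.sum_add_distrib]
          exact add_le_add (eVariationOn.sum_le hu hus) (eVariationOn.sum_le hu hus)
  · dsimp only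
    rw [← hpe hx, ← hqe hx, sub_sub_cancel]

lemma exists_monotone_Ioc_iUnion_eq_univ [TopologicalSpace α] [OrderTopology α]
    [SecondCountableTopology α] [NoMinOrder α] [Nonempty α] :
    ∃ a b : ℕ → α, Monotone (fun n => Ioc (a n) (b n)) ∧ ⋃ n, Ioc (a n) (b n) = univ := by
  obtain ⟨a, ha, hat⟩ := exists_seq_antitone_tendsto_atTop_atBot α
  obtain ⟨b, hb, hbt⟩ := exists_seq_monotone_tendsto_atTop_atTop α
  refine ⟨a, b, fun i j hij => Ioc_subset_Ioc (ha hij) (hb hij), eq_univ_of_forall fun x => ?_⟩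
  obtain ⟨y, hy⟩ := exists_lt x
  obtain ⟨n, h1, h2⟩ :=
    ((hat.eventually (eventually_le_atBot y)).and (hbt.eventually (eventually_ge_atTop x))).exists
  exact mem_iUnion.2 ⟨n, h1.trans_lt hy, h2⟩

variable [TopologicalSpace α] [OrderTopology α] [DenselyOrdered α]

/-- The variation of the right limits is at most the variation over any dense set. -/
theorem eVariationOn_rightLim_le_of_dense [NoMaxOrder α] {f : α → ℝ}
    (hf : BoundedVariationOn f univ) {s : Set α} (hs : Dense s) :
    eVariationOn f.rightLim univ ≤ eVariationOn f s := by
  refine iSup_le fun ⟨n, u, hu, _⟩ => ?_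
  dsimp only
  refine ENNReal.le_of_forall_pos_le_add fun ε hε _ => ?_
  set η : ℝ≥0 := ε / (2 * (n + 1)) with hη
  have hηpos : 0 < η := by positivity
  -- a point of `s` slightly to the right of `x`, to the left of all later points `u i`
  have hex : ∀ x, ∃ y ∈ s, x < y ∧ edist (f y) (f.rightLim x) ≤ η ∧
      ∀ i ∈ Finset.range (n + 1), x < u i → y < u i := by
    intro x
    have h1 : ∀ᶠ y in 𝓝[>] x, edist (f y) (f.rightLim x) ≤ η :=
      ((tendsto_order.1 (tendsto_iff_edist_tendsto_0.1 (hf.tendsto_rightLim x))).2 _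
        (by exact_mod_cast hηpos)).mono fun _ => le_of_lt
    have h2 : ∀ᶠ y in 𝓝[>] x, ∀ i ∈ Finset.range (n + 1), x < u i → y < u i := by
      rw [Filter.eventually_all_finset]
      intro i _
      by_cases h : x < u i
      · filter_upwards [Ioo_mem_nhdsGT h] with y hy _ using hy.2
      · exact Eventually.of_forall fun _ h' => absurd h' h
    obtain ⟨b, hb, hbs⟩ := (mem_nhdsGT_iff_exists_Ioo_subset).1 (h1.and h2)
    obtain ⟨y, hy, hys⟩ := hs.inter_open_nonempty _ isOpen_Ioo (nonempty_Ioo.2 hb)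
    exact ⟨y, hys, hy.1, (hbs hy).1, (hbs hy).2⟩
  choose e hes hlt hed hlater using hex
  have hmono : MonotoneOn (fun i => e (u i)) (Iic n) := by
    intro i hi j hj hij
    rcases (hu hij).eq_or_lt with h | h
    · exact (congrArg e h).le
    · exact ((hlater (u i) j (Finset.mem_range_succ_iff.2 hj) h).trans (hlt _)).le
  calc ∑ i ∈ Finset.range n, edist (f.rightLim (u (i + 1))) (f.rightLim (u i))
      ≤ ∑ i ∈ Finset.range n, (edist (f (e (u (i + 1)))) (f (e (u i))) + 2 * η) := by
        refine Finset.sum_le_sum fun i _ => ?_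
        have h1 := hed (u i)
        have h2 := hed (u (i + 1))
        rw [edist_comm] at h2
        calc _ ≤ edist (f.rightLim (u (i + 1))) (f (e (u (i + 1)))) +
              edist (f (e (u (i + 1)))) (f (e (u i))) + edist (f (e (u i))) (f.rightLim (u i)) :=
              edist_triangle4 _ _ _ _
          _ ≤ η + edist (f (e (u (i + 1)))) (f (e (u i))) + η := by gcongr
          _ = _ := by ring
    _ = ∑ i ∈ Finset.range n, edist (f (e (u (i + 1)))) (f (e (u i))) + n * (2 * η) := by
        rw [Finset.sum_add_distrib]; simp
    _ ≤ eVariationOn f s + ε := by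
        gcongr
        · exact eVariationOn.sum_le_of_monotoneOn_Iic hmono fun i _ => hes _
        · have : (n : ℝ≥0) * (2 * η) ≤ ε := by
            rw [hη, ← NNReal.coe_le_coe]
            push_cast
            rw [← mul_div_assoc, ← mul_div_assoc, div_le_iff₀ (by positivity)]
            nlinarith [ε.coe_nonneg]
          exact_mod_cast this

variable [SecondCountableTopology α] [CompactIccSpace α] [MeasurableSpace α] [BorelSpace α]

/-- The increments of the right limits along a monotone sequence add up to at most the total
variation of the measure. -/
lemma sum_abs_rightLim_le {f : α → ℝ} (hf : BoundedVariationOn f univ) {u : ℕ → α}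
    (hu : Monotone u) (n : ℕ) :
    ∑ i ∈ Finset.range n, ENNReal.ofReal |f.rightLim (u (i + 1)) - f.rightLim (u i)| ≤
      hf.vectorMeasure.variation univ := by
  calc ∑ i ∈ Finset.range n, ENNReal.ofReal |f.rightLim (u (i + 1)) - f.rightLim (u i)|
      ≤ ∑ i ∈ Finset.range n, hf.vectorMeasure.variation (Ioc (u i) (u (i + 1))) := by
        refine Finset.sum_le_sum fun i _ => ?_
        rw [← hf.vectorMeasure_Ioc (hu i.le_succ), ← Real.norm_eq_abs, ofReal_norm]
        exact VectorMeasure.enorm_measure_le_variation _ _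
    _ = hf.vectorMeasure.variation (⋃ i ∈ Finset.range n, Ioc (u i) (u (i + 1))) := by
        rw [measure_biUnion_finset]
        · intro i _ j _ hij
          exact hu.pairwise_disjoint_on_Ioc_succ hij
        · exact fun _ _ => measurableSet_Ioc
    _ ≤ _ := measure_mono (subset_univ _)

variable [NoMinOrder α] [Nonempty α]

/-- The vector measure of a function of bounded variation is dominated by the Stieltjes measure of
the variation of its right limits. -/
lemma enorm_vectorMeasure_le {f : α → ℝ} (hf : BoundedVariationOn f univ) (x₀ : α) (s : Set α) :
    ‖hf.vectorMeasure s‖ₑ ≤ (hf.stieltjesFunctionRightLim x₀).measure s := by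
  have hfin : IsFiniteMeasure (hf.stieltjesFunctionRightLim x₀).measure :=
    StieltjesFunction.isFiniteMeasure_of_forall_abs_le
      (C := (eVariationOn f.rightLim univ).toReal) _
      fun x => variationOnFromTo.abs_le_eVariationOn hf.rightLim
  let m := AddContent.onIoc f.rightLim
  have A : ∀ s ∈ {s | ∃ u v, u ≤ v ∧ s = Ioc u v},
      ‖m s‖ₑ ≤ (hf.stieltjesFunctionRightLim x₀).measure s := by
    rintro s ⟨u, v, huv, rfl⟩
    rw [AddContent.onIoc_apply huv, StieltjesFunction.measure_Ioc,
      BoundedVariationOn.stieltjesFunctionRightLim_apply,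
      BoundedVariationOn.stieltjesFunctionRightLim_apply,
      ← variationOnFromTo.add hf.rightLim.locallyBoundedVariationOn (mem_univ x₀) (mem_univ u)
        (mem_univ v), add_sub_cancel_left, variationOnFromTo, if_pos huv, univ_inter,
      ENNReal.ofReal_toReal
        ((eVariationOn.mono _ (subset_univ _)).trans_lt hf.rightLim.lt_top).ne,
      ← edist_eq_enorm_sub]
    exact eVariationOn.edist_le _ ⟨huv, le_rfl⟩ ⟨le_rfl, huv⟩
  have B : ‹MeasurableSpace α› =
      MeasurableSpace.generateFrom {s | ∃ u v : α, u ≤ v ∧ s = Ioc u v} := by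
    borelize α
    convert! borel_eq_generateFrom_Ioc_le α using 2
    grind only
  obtain ⟨m', hm', h'm'⟩ :=
    VectorMeasure.exists_extension_of_isSetSemiring_of_le_measure_of_generateFrom
      IsSetSemiring.Ioc A B
  have hIoc : ∀ u v, u ≤ v → m' (Ioc u v) = hf.vectorMeasure (Ioc u v) := fun u v huv => by
    rw [hm' _ ⟨u, v, huv, rfl⟩, hf.vectorMeasure_Ioc huv]
    exact AddContent.onIoc_apply huv
  -- the dominated extension agrees with the vector measure on the generating intervals
  have heq : m' = hf.vectorMeasure := by
    refine VectorMeasure.ext_of_generateFrom _ (fun s hs => ?_) B ?_ ?_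
    · obtain ⟨u, v, huv, rfl⟩ := hs
      exact hIoc u v huv
    · rintro _ ⟨u, v, huv, rfl⟩ _ ⟨u', v', huv', rfl⟩ h
      rw [Ioc_inter_Ioc] at h ⊢
      obtain ⟨z, hz⟩ := h
      exact ⟨_, _, hz.1.le.trans hz.2, rfl⟩
    · obtain ⟨a, b, hmono, hun⟩ := exists_monotone_Ioc_iUnion_eq_univ (α := α)
      have h1 := m'.tendsto_vectorMeasure_iUnion_atTop_nat hmono (fun _ => measurableSet_Ioc)
      have h2 := hf.vectorMeasure.tendsto_vectorMeasure_iUnion_atTop_nat hmono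
        (fun _ => measurableSet_Ioc)
      rw [hun] at h1 h2
      refine tendsto_nhds_unique h1 (h2.congr fun n => ?_)
      rcases le_total (a n) (b n) with h | h
      · exact (hIoc _ _ h).symm
      · simp [Ioc_eq_empty h.not_gt]
  rw [← heq]
  exact h'm' s

/-- The total variation of the measure of `f` is at most the variation of the right limits. -/
theorem variation_vectorMeasure_univ_le {f : α → ℝ} (hf : BoundedVariationOn f univ) :
    hf.vectorMeasure.variation univ ≤ eVariationOn f.rightLim univ := by
  inhabit α
  have h1 := VectorMeasure.variation_le_of_forall_enorm_le
    (fun s _ => enorm_vectorMeasure_le hf default s)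
  refine (h1 univ).trans ?_
  obtain ⟨a, b, hmono, hun⟩ := exists_monotone_Ioc_iUnion_eq_univ (α := α)
  rw [← hun, hmono.measure_iUnion, hun]
  refine iSup_le fun n => ?_
  rw [StieltjesFunction.measure_Ioc, BoundedVariationOn.stieltjesFunctionRightLim_apply,
    BoundedVariationOn.stieltjesFunctionRightLim_apply]
  rw [← variationOnFromTo.add hf.rightLim.locallyBoundedVariationOn (mem_univ default)
    (mem_univ (a n)) (mem_univ (b n)), add_sub_cancel_left]
  exact ENNReal.ofReal_le_of_le_toReal
    ((le_abs_self _).trans (variationOnFromTo.abs_le_eVariationOn hf.rightLim))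

end BoundedVariation

/-! ### Primitives on the interval -/

variable {c d : EReal}

lemma nonempty_interval (h : c < d) : Nonempty (interval c d) := by
  obtain ⟨x, h1, h2⟩ := EReal.lt_iff_exists_real_btwn.1 h
  exact ⟨⟨x, h1, h2⟩⟩

instance instNoMaxOrderInterval : NoMaxOrder (interval c d) where
  exists_gt x := by
    obtain ⟨y, h1, h2⟩ := EReal.lt_iff_exists_real_btwn.1 x.2.2
    exact ⟨⟨y, x.2.1.trans h1, h2⟩, EReal.coe_lt_coe_iff.1 h1⟩

instance instNoMinOrderInterval : NoMinOrder (interval c d) where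
  exists_lt x := by
    obtain ⟨y, h1, h2⟩ := EReal.lt_iff_exists_real_btwn.1 x.2.1
    exact ⟨⟨y, h1, h2.trans x.2.2⟩, EReal.coe_lt_coe_iff.1 h2⟩

lemma isOpen_interval : IsOpen (interval c d) :=
  isOpen_Ioo.preimage continuous_coe_real_ereal

instance instNullSingletonClassInterval :
    NullSingletonClass (volume : Measure (interval c d)) where
  measure_singleton x := by
    rw [Measure.Subtype.volume_def, comap_subtype_coe_apply isOpen_interval.measurableSet,
      image_singleton, measure_singleton]

instance instIsOpenPosMeasureInterval :
    (volume : Measure (interval c d)).IsOpenPosMeasure where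
  open_pos U hU hne h0 := by
    have h1 := isOpen_interval.isOpenMap_subtype_val U hU
    rw [Measure.Subtype.volume_def,
      comap_subtype_coe_apply isOpen_interval.measurableSet] at h0
    exact h1.measure_ne_zero _ (hne.image _) h0

instance instPreconnectedSpaceInterval : PreconnectedSpace (interval c d) :=
  isPreconnected_iff_preconnectedSpace.1 (instOrdConnectedInterval c d).isPreconnected

instance instPolishSpaceInterval : PolishSpace (interval c d) :=
  isOpen_interval.polishSpace

lemma _root_.EReal.abs_eq_enorm_toReal {x : EReal} (hx : x.abs < ∞) : x.abs = ‖x.toReal‖ₑ := by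
  induction x with
  | bot => simp at hx
  | top => simp at hx
  | coe x => rw [EReal.abs_def, EReal.toReal_coe, ← ofReal_norm, Real.norm_eq_abs]

lemma _root_.EReal.coe_toReal_of_abs_lt_top {x : EReal} (hx : x.abs < ∞) :
    (x.toReal : EReal) = x := by
  induction x with
  | bot => simp at hx
  | top => simp at hx
  | coe x => rfl

lemma _root_.EReal.enorm_toReal_le_abs (x : EReal) : ‖x.toReal‖ₑ ≤ x.abs := by
  induction x with
  | bot => simp
  | top => simp
  | coe x => rw [EReal.abs_def, EReal.toReal_coe, ← ofReal_norm, Real.norm_eq_abs]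

lemma _root_.EReal.abs_eq_toENNReal {x : EReal} (hx : 0 ≤ x) : x.abs = x.toENNReal := by
  induction x with
  | bot => simp at hx
  | top => simp
  | coe x =>
    rw [EReal.abs_def, abs_of_nonneg (EReal.coe_nonneg.1 hx)]; simp

lemma measurable_abs : Measurable EReal.abs := by
  have : EReal.abs = fun x : EReal => max x.toENNReal (-x).toENNReal := by
    ext1 x
    rcases le_total 0 x with h | h
    · have h' : -x ≤ 0 := by
        rw [← EReal.neg_le_neg_iff, neg_neg, neg_zero]; exact h
      rw [EReal.abs_eq_toENNReal h, EReal.toENNReal_of_nonpos h', max_eq_left zero_le]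
    · rw [← EReal.abs_neg, EReal.abs_eq_toENNReal (by simpa using EReal.neg_le_neg_iff.2 h),
        EReal.toENNReal_of_nonpos h, max_eq_right zero_le]
  rw [this]
  exact measurable_ereal_toENNReal.max (measurable_ereal_toENNReal.comp continuous_neg.measurable)

lemma LocallyL1.ae_abs_lt_top {f : interval c d → EReal} (hf : LocallyL1 f)
    (hfm : AEMeasurable f) : ∀ᵐ t, (f t).abs < ∞ := by
  rcases isEmpty_or_nonempty (interval c d) with h | h
  · exact ae_of_all _ fun t => h.elim t
  obtain ⟨b, hb, hbt⟩ := exists_seq_monotone_tendsto_atTop_atTop (interval c d)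
  have hun : ⋃ n, Iio (b n) = univ := eq_univ_of_forall fun x => by
    obtain ⟨n, hn⟩ := (hbt.eventually (eventually_gt_atTop x)).exists
    exact mem_iUnion.2 ⟨n, hn⟩
  rw [← Measure.restrict_univ (μ := volume), ← hun, ae_restrict_iUnion_iff]
  exact fun n => ae_lt_top' (measurable_abs.comp_aemeasurable hfm.restrict) (hf (b n)).ne

lemma LocallyL1.integrableOn {f : interval c d → EReal} (hf : LocallyL1 f)
    (hfm : AEMeasurable f) (x : interval c d) : IntegrableOn (fun t => (f t).toReal) (Iio x) :=
  ⟨(measurable_ereal_toReal.comp_aemeasurable hfm.restrict).aestronglyMeasurable,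
    (lintegral_mono fun _ => EReal.enorm_toReal_le_abs _).trans_lt (hf x)⟩

/-- Primitives of locally integrable functions are continuous. -/
lemma continuous_setIntegral_Iio {f : interval c d → ℝ} (hf : ∀ x, IntegrableOn f (Iio x)) :
    Continuous fun x => ∫ t in Iio x, f t := by
  refine continuous_iff_continuousAt.2 fun x => ?_
  obtain ⟨b, hb⟩ := exists_gt x
  simp only [← integral_indicator measurableSet_Iio]
  refine continuousAt_of_dominated (bound := (Iio b).indicator fun t => ‖f t‖) ?_ ?_ ?_ ?_
  · exact Eventually.of_forall fun y =>
      ((integrable_indicator_iff measurableSet_Iio).2 (hf y)).aestronglyMeasurable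
  · filter_upwards [Iio_mem_nhds hb] with y hy
    refine ae_of_all _ fun t => ?_
    rw [norm_indicator_eq_indicator_norm]
    exact indicator_le_indicator_of_subset (Iio_subset_Iio (le_of_lt hy)) (fun _ => norm_nonneg _) t
  · exact (integrable_indicator_iff measurableSet_Iio).2 (hf b).norm
  · have : ∀ᵐ t, t ≠ x := by
      simp [ae_iff, measure_singleton]
    filter_upwards [this] with t ht
    rcases lt_or_gt_of_ne ht with h | h
    · refine (continuousAt_const (y := f t)).congr ?_
      filter_upwards [Ioi_mem_nhds h] with y hy
      exact (indicator_of_mem (show t ∈ Iio y from hy) _).symm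
    · refine (continuousAt_const (y := (0 : ℝ))).congr ?_
      filter_upwards [Iio_mem_nhds h] with y hy
      exact (indicator_of_notMem (by simpa using le_of_lt hy) _).symm

lemma LocallyL1.continuous_primitive {f : interval c d → EReal} (hf : LocallyL1 f)
    (hfm : AEMeasurable f) : Continuous (primitive f) :=
  continuous_setIntegral_Iio (hf.integrableOn hfm)

/-! ### The weighted measure and its distribution function -/

/-- The measure `v dx` on the interval. -/
def weightMeasure (v : interval c d → EReal) : Measure (interval c d) :=
  volume.withDensity fun t => (v t).toENNReal

section Weight

variable {v : interval c d → EReal} {w : interval c d → ℝ}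

lemma IsWeight.aemeasurable_toENNReal (hw : IsWeight v w) :
    AEMeasurable fun t => (v t).toENNReal :=
  measurable_ereal_toENNReal.comp_aemeasurable hw.aemeasurable

lemma IsWeight.primitive_pos (hw : IsWeight v w) (x : interval c d) : 0 < primitive v x := by
  have := hw.pos x
  rw [hw.eq_inv] at this
  exact inv_pos.1 this

lemma IsWeight.continuous_primitive (hw : IsWeight v w) : Continuous (primitive v) :=
  hw.locallyL1.continuous_primitive hw.aemeasurable

lemma IsWeight.toReal_ae_eq (hw : IsWeight v w) (hv : ∀ᵐ t, 0 < v t) :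
    ∀ᵐ t, 0 < (v t).toReal ∧ ((v t).toReal : EReal) = v t ∧
      ENNReal.ofReal (v t).toReal = (v t).toENNReal ∧ (v t).abs = (v t).toENNReal := by
  filter_upwards [hv, hw.locallyL1.ae_abs_lt_top hw.aemeasurable] with t h0 h1
  have h2 := EReal.coe_toReal_of_abs_lt_top h1
  refine ⟨EReal.coe_lt_coe_iff.1 (by rw [h2]; exact h0), h2, ?_, EReal.abs_eq_toENNReal h0.le⟩
  conv_rhs => rw [← h2]
  simp

lemma IsWeight.absolutelyContinuous (hw : IsWeight v w) (hv : ∀ᵐ t, 0 < v t) :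
    volume ≪ weightMeasure v :=
  withDensity_absolutelyContinuous' hw.aemeasurable_toENNReal
    (hv.mono fun _ ht => EReal.toENNReal_ne_zero_iff.2 ht)

lemma weightMeasure_absolutelyContinuous : weightMeasure v ≪ volume :=
  withDensity_absolutelyContinuous _ _

instance instNullSingletonClassWeightMeasure : NullSingletonClass (weightMeasure v) :=
  ⟨fun x => weightMeasure_absolutelyContinuous (measure_singleton x)⟩

lemma IsWeight.weightMeasure_Iio (hw : IsWeight v w) (hv : ∀ᵐ t, 0 < v t) (x : interval c d) :
    weightMeasure v (Iio x) = ENNReal.ofReal (primitive v x) := by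
  have h := hw.toReal_ae_eq hv
  rw [weightMeasure, withDensity_apply _ measurableSet_Iio, primitive,
    ofReal_integral_eq_lintegral_ofReal (hw.locallyL1.integrableOn hw.aemeasurable x)
      (ae_restrict_of_ae (h.mono fun t ht => ht.1.le))]
  exact lintegral_congr_ae (ae_restrict_of_ae (h.mono fun t ht => ht.2.2.1.symm))

lemma IsWeight.strictMono_primitive (hw : IsWeight v w) (hv : ∀ᵐ t, 0 < v t) :
    StrictMono (primitive v) := by
  intro x y hxy
  have h1 : weightMeasure v (Ico x y) ≠ 0 := fun h0 => by
    have h2 := hw.absolutelyContinuous hv h0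
    have h3 : (Ioo x y).Nonempty := nonempty_Ioo.2 hxy
    exact isOpen_Ioo.measure_ne_zero volume h3 (measure_mono_null Ioo_subset_Ico_self h2)
  have h2 : weightMeasure v (Iio y) = weightMeasure v (Iio x) + weightMeasure v (Ico x y) := by
    rw [← Iio_union_Ico_eq_Iio hxy.le, measure_union _ measurableSet_Ico]
    exact Set.disjoint_left.2 fun t h3 h4 => (not_le.2 h3) h4.1
  rw [hw.weightMeasure_Iio hv, hw.weightMeasure_Iio hv] at h2
  refine (ENNReal.ofReal_lt_ofReal_iff (hw.primitive_pos y)).1 ?_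
  rw [h2]
  exact ENNReal.lt_add_right ENNReal.ofReal_ne_top h1

/-- The distribution function `V` maps the interval onto `(0, ∞)`. -/
lemma IsWeight.exists_primitive_eq (hw : IsWeight v w) (hv : ∀ᵐ t, 0 < v t)
    [hne : Nonempty (interval c d)] {y : ℝ} (hy : 0 < y) : ∃ x, primitive v x = y := by
  obtain ⟨b, hb⟩ := (hw.tendsto.eventually (eventually_ge_atTop y)).exists
  obtain ⟨a, ha, hat⟩ := exists_seq_antitone_tendsto_atTop_atBot (interval c d)
  have h1 : Tendsto (fun n => weightMeasure v (Iio (a n))) atTop (𝓝 0) := by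
    have h2 : ⋂ n, Iio (a n) = ∅ := eq_empty_of_forall_notMem fun x hx => by
      obtain ⟨n, hn⟩ := (hat.eventually (eventually_le_atBot x)).exists
      exact absurd (mem_iInter.1 hx n) (not_lt.2 hn)
    rw [← measure_empty (μ := weightMeasure v), ← h2]
    refine tendsto_measure_iInter_atTop (fun n => measurableSet_Iio.nullMeasurableSet)
      (fun i j hij => Iio_subset_Iio (ha hij)) ⟨0, ?_⟩
    rw [hw.weightMeasure_Iio hv]; exact ENNReal.ofReal_ne_top
  obtain ⟨n, hn⟩ := ((tendsto_order.1 h1).2 (ENNReal.ofReal y) (by simpa using hy)).exists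
  rw [hw.weightMeasure_Iio hv, ENNReal.ofReal_lt_ofReal_iff hy] at hn
  exact mem_range_of_exists_le_of_exists_ge hw.continuous_primitive ⟨a n, hn.le⟩ ⟨b, hb⟩

lemma IsWeight.measurableEmbedding_primitive (hw : IsWeight v w) (hv : ∀ᵐ t, 0 < v t) :
    MeasurableEmbedding (primitive v) :=
  hw.continuous_primitive.measurableEmbedding (hw.strictMono_primitive hv).injective

lemma IsWeight.preimage_Iic (hw : IsWeight v w) (hv : ∀ᵐ t, 0 < v t)
    [hne : Nonempty (interval c d)] (y : ℝ) :
    weightMeasure v (primitive v ⁻¹' Iic y) = ENNReal.ofReal y := by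
  rcases le_or_gt y 0 with h | h
  · have : primitive v ⁻¹' Iic y = ∅ := eq_empty_of_forall_notMem fun x hx =>
      absurd (hw.primitive_pos x) (not_lt.2 (le_trans hx h))
    rw [this, measure_empty, ENNReal.ofReal_of_nonpos h]
  · obtain ⟨x, rfl⟩ := hw.exists_primitive_eq hv h
    have : primitive v ⁻¹' Iic (primitive v x) = Iic x := by
      ext t; simp [(hw.strictMono_primitive hv).le_iff_le]
    rw [this, ← measure_congr Iio_ae_eq_Iic, hw.weightMeasure_Iio hv]

/-- The distribution function `V` carries `v dx` to Lebesgue measure on `(0, ∞)`. -/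
theorem IsWeight.map_primitive (hw : IsWeight v w) (hv : ∀ᵐ t, 0 < v t)
    [hne : Nonempty (interval c d)] :
    (weightMeasure v).map (primitive v) = volume.restrict (Ioi 0) := by
  have hm := (hw.measurableEmbedding_primitive hv).measurable
  have key : ∀ a b : ℝ, a < b → (weightMeasure v).map (primitive v) (Ioc a b) =
      ENNReal.ofReal b - ENNReal.ofReal a := by
    intro a b hab
    rw [Measure.map_apply hm measurableSet_Ioc,
      show Ioc a b = Iic b \ Iic a by ext; simp [and_comm], preimage_sdiff,
      measure_sdiff (preimage_mono (Iic_subset_Iic.2 hab.le))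
        (hm measurableSet_Iic).nullMeasurableSet, hw.preimage_Iic hv, hw.preimage_Iic hv]
    rw [hw.preimage_Iic hv]; exact ENNReal.ofReal_ne_top
  refine Measure.ext_of_Ioc' _ _ (fun a b hab => ?_) fun a b hab => ?_
  · rw [key a b hab]; exact (tsub_le_self.trans_lt ENNReal.ofReal_lt_top).ne
  · rw [key a b hab, Measure.restrict_apply measurableSet_Ioc]
    rcases le_or_gt a 0 with ha | ha
    · have : Ioc a b ∩ Ioi 0 = Ioc 0 b := by
        ext t; simp only [mem_inter_iff, mem_Ioc, mem_Ioi]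
        exact ⟨fun h => ⟨h.2, h.1.2⟩, fun h => ⟨⟨ha.trans_lt h.1, h.2⟩, h.1⟩⟩
      rw [this, Real.volume_Ioc, ENNReal.ofReal_of_nonpos ha]; simp
    · have : Ioc a b ∩ Ioi 0 = Ioc a b := inter_eq_left.2 fun t ht => ha.trans ht.1
      rw [this, Real.volume_Ioc, ENNReal.ofReal_sub _ ha.le]

end Weight

/-! ### Transfer to the half-line and the lower bounds -/

section Transfer

variable {c d : EReal} {v : interval c d → EReal} {w : interval c d → ℝ}

lemma IsWeight.toENNReal_lt_top (hw : IsWeight v w) (hv : ∀ᵐ t, 0 < v t) :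
    ∀ᵐ t, (v t).toENNReal < ∞ :=
  (hw.toReal_ae_eq hv).mono fun t ht => by rw [← ht.2.2.1]; exact ENNReal.ofReal_lt_top

lemma IsWeight.integral_comp_primitive (hw : IsWeight v w) (hv : ∀ᵐ t, 0 < v t)
    [Nonempty (interval c d)] (q : ℝ → ℝ) :
    ∫ t, q (primitive v t) * (v t).toReal = ∫ y in Ioi 0, q y := by
  rw [← hw.map_primitive hv, (hw.measurableEmbedding_primitive hv).integral_map, weightMeasure,
    integral_withDensity_eq_integral_toReal_smul₀ hw.aemeasurable_toENNReal
      (hw.toENNReal_lt_top hv)]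
  refine integral_congr_ae ((hw.toReal_ae_eq hv).mono fun t ht => ?_)
  dsimp only
  rw [← ht.2.2.1, ENNReal.toReal_ofReal ht.1.le, smul_eq_mul, mul_comm]

lemma IsWeight.lintegral_comp_primitive (hw : IsWeight v w) (hv : ∀ᵐ t, 0 < v t)
    [Nonempty (interval c d)] (q : ℝ → ℝ≥0∞) :
    ∫⁻ t, (v t).toENNReal * q (primitive v t) = ∫⁻ y in Ioi 0, q y := by
  rw [← hw.map_primitive hv, (hw.measurableEmbedding_primitive hv).lintegral_map, weightMeasure,
    lintegral_withDensity_eq_lintegral_mul_non_measurable₀ _ hw.aemeasurable_toENNReal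
      (hw.toENNReal_lt_top hv)]
  rfl

lemma IsWeight.setIntegral_comp_primitive (hw : IsWeight v w) (hv : ∀ᵐ t, 0 < v t)
    [Nonempty (interval c d)] (p : ℝ → ℝ) (x : interval c d) :
    ∫ t in Iio x, p (primitive v t) * (v t).toReal = ∫ y in Ioc 0 (primitive v x), p y := by
  have h1 := hw.integral_comp_primitive hv ((Iio (primitive v x)).indicator p)
  rw [setIntegral_indicator measurableSet_Iio, Ioi_inter_Iio,
    setIntegral_congr_set Ioo_ae_eq_Ioc] at h1
  rw [← h1, ← integral_indicator measurableSet_Iio]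
  refine integral_congr_ae (ae_of_all _ fun t => ?_)
  by_cases h : t < x
  · have h' := hw.strictMono_primitive hv h
    simp [h, h']
  · have h' : ¬ primitive v t < primitive v x := by
      rwa [(hw.strictMono_primitive hv).lt_iff_lt]
    simp [h, h']

/-- The class of `(p ∘ V) v`, the density on the interval that corresponds to the density `p` on the
half-line. -/
def IsWeight.transport (hw : IsWeight v w) (p : ℝ → ℝ) (hp : Measurable p) : L0 c d :=
  AEEqFun.mk (fun t => ((p (primitive v t) * (v t).toReal : ℝ) : EReal))
    (measurable_coe_real_ereal.comp_aemeasurable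
      ((hp.comp hw.continuous_primitive.measurable).aemeasurable.mul
        (measurable_ereal_toReal.comp_aemeasurable hw.aemeasurable))).aestronglyMeasurable

lemma IsWeight.transport_ae_eq (hw : IsWeight v w) (p : ℝ → ℝ) (hp : Measurable p) :
    ∀ᵐ t, hw.transport p hp t = ((p (primitive v t) * (v t).toReal : ℝ) : EReal) :=
  AEEqFun.coeFn_mk _ _

lemma IsWeight.enorm_mul_le (hw : IsWeight v w) {x : interval c d} {a C : ℝ}
    (ha : |a| ≤ C * primitive v x) : ‖w x * a‖ₑ ≤ ENNReal.ofReal C := by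
  have hV := hw.primitive_pos x
  rw [hw.eq_inv, ← ofReal_norm, Real.norm_eq_abs, abs_mul, abs_of_pos (inv_pos.2 hV)]
  refine ENNReal.ofReal_le_ofReal ?_
  rw [inv_mul_le_iff₀ hV, mul_comm]
  exact ha

lemma IsWeight.transport_mem_ces (hw : IsWeight v w) (hv : ∀ᵐ t, 0 < v t)
    {p : ℝ → ℝ} (hp : Measurable p) {C : ℝ} (hC : ∀ t, |p t| ≤ C) :
    hw.transport p hp ∈ Ces w := by
  have hae := hw.transport_ae_eq p hp
  have habs : ∀ᵐ t, (hw.transport p hp t).abs =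
      ENNReal.ofReal (|p (primitive v t)| * (v t).toReal) := by
    filter_upwards [hae, hw.toReal_ae_eq hv] with t ht hvt
    rw [ht, EReal.abs_def, abs_mul, abs_of_pos hvt.1]
  refine ⟨fun x => ?_, ?_⟩
  · calc ∫⁻ t in Iio x, (hw.transport p hp t).abs
        ≤ ∫⁻ t in Iio x, ENNReal.ofReal C * (v t).abs := by
          refine lintegral_mono_ae (ae_restrict_of_ae ?_)
          filter_upwards [habs, hw.toReal_ae_eq hv] with t ht hvt
          rw [ht, hvt.2.2.2, ← hvt.2.2.1, ENNReal.ofReal_mul (abs_nonneg _)]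
          gcongr
          exact hC _
      _ < ∞ := by
          rw [lintegral_const_mul' _ _ ENNReal.ofReal_ne_top]
          exact ENNReal.mul_lt_top ENNReal.ofReal_lt_top (hw.locallyL1 x)
  · refine lt_of_le_of_lt (essSup_le_of_ae_le (ENNReal.ofReal C) (ae_of_all _ fun x => ?_))
      ENNReal.ofReal_lt_top
    refine hw.enorm_mul_le ?_
    have h1 : primitive (fun t => ((hw.transport p hp t).abs : EReal)) x =
        ∫ t in Iio x, |p (primitive v t)| * (v t).toReal := by
      refine integral_congr_ae (ae_restrict_of_ae ?_)
      filter_upwards [habs, hw.toReal_ae_eq hv] with t ht hvt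
      rw [ht, EReal.toReal_coe_ennreal,
        ENNReal.toReal_ofReal (mul_nonneg (abs_nonneg _) hvt.1.le)]
    rw [h1, abs_of_nonneg, primitive, ← integral_const_mul]
    · refine integral_mono_of_nonneg (ae_restrict_of_ae ?_)
        ((hw.locallyL1.integrableOn hw.aemeasurable x).const_mul C) (ae_restrict_of_ae ?_)
      · exact (hw.toReal_ae_eq hv).mono fun t ht => mul_nonneg (abs_nonneg _) ht.1.le
      · exact (hw.toReal_ae_eq hv).mono fun t ht => mul_le_mul_of_nonneg_right (hC _) ht.1.le
    · exact integral_nonneg_of_ae (ae_restrict_of_ae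
        ((hw.toReal_ae_eq hv).mono fun t ht => mul_nonneg (abs_nonneg _) ht.1.le))

lemma IsWeight.alteredNorm_transport_le (hw : IsWeight v w) (hv : ∀ᵐ t, 0 < v t)
    [Nonempty (interval c d)] {p : ℝ → ℝ} (hp : Measurable p)
    (hp1 : ∀ y > 0, |∫ t in Ioc 0 y, p t| ≤ y) : alteredNorm w (hw.transport p hp) ≤ 1 := by
  refine essSup_le_of_ae_le 1 (ae_of_all _ fun x => ?_)
  have h1 : primitive (hw.transport p hp) x = ∫ y in Ioc 0 (primitive v x), p y := by
    rw [← hw.setIntegral_comp_primitive hv]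
    exact integral_congr_ae (ae_restrict_of_ae ((hw.transport_ae_eq p hp).mono fun t ht => by
      dsimp only; rw [ht, EReal.toReal_coe]))
  dsimp only
  rw [h1, ← ENNReal.ofReal_one]
  exact hw.enorm_mul_le (by rw [one_mul]; exact hp1 _ (hw.primitive_pos x))

lemma enorm_integral_le_of_alteredNorm_le_one {X : Set (L0 c d)} {N : L0 c d → ℝ≥0∞} {g f : L0 c d}
    (hf : f ∈ X) (hN : N f ≤ 1) :
    ‖∫ x, (f x * g x).toReal‖ₑ ≤ weakAssociateNorm X N g := by
  by_cases h0 : f = 0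
  · have : ∫ x, (f x * g x).toReal = 0 := by
      rw [h0]
      refine integral_eq_zero_of_ae ?_
      filter_upwards [AEEqFun.coeFn_zero (α := interval c d) (β := EReal) (μ := volume)] with x hx
      simp [hx]
    rw [this]; simp
  · refine le_trans ?_ (le_iSup₂_of_le f hf (le_iSup_of_le h0 le_rfl))
    calc _ = ‖∫ x, (f x * g x).toReal‖ₑ / 1 := (div_one _).symm
      _ ≤ _ := ENNReal.div_le_div_left hN _

lemma IsWeight.ae_of_ae_half_line (hw : IsWeight v w) (hv : ∀ᵐ t, 0 < v t)
    [Nonempty (interval c d)] {P : ℝ → Prop} (h : ∀ᵐ y ∂volume.restrict (Ioi 0), P y) :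
    ∀ᵐ t, P (primitive v t) := by
  rw [← hw.map_primitive hv] at h
  exact (hw.absolutelyContinuous hv).ae_le
    (ae_of_ae_map (hw.measurableEmbedding_primitive hv).measurable.aemeasurable h)

/-- Everything that membership in the weak associate space says about `g`, in terms of the weak
associate norm `N`: the weighted integral of `|g|`, the variation of `V g` over a set of full
measure, and the weighted integral of the least decreasing majorant of `|g|`. -/
theorem IsWeight.bounds_of_mem_weakAssociate (hw : IsWeight v w) (hv : ∀ᵐ t, 0 < v t)
    [Nonempty (interval c d)] {g : L0 c d} (hg : g ∈ weakAssociate (Ces w) (alteredNorm w)) :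
    (∀ᵐ t, (g t).abs < ∞) ∧
    l1Norm (fun x => v x * g x) ≤ weakAssociateNorm (Ces w) (alteredNorm w) g ∧
    (∃ E : Set (interval c d), (∀ᵐ t, t ∈ E) ∧
      eVariationOn (fun t => primitive v t * (g t).toReal) E ≤
        2 * weakAssociateNorm (Ces w) (alteredNorm w) g) ∧
    ∫⁻ t, (v t).toENNReal * essSup (fun x => (g x).abs) (volume.restrict (Ici t)) ≤
      weakAssociateNorm (Ces w) (alteredNorm w) g := by
  have hvt := hw.toReal_ae_eq hv
  -- the weight itself is the test function with density `1`
  have hvg : l1Norm (fun x => v x * g x) < ∞ := by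
    have h1 := hg.1 _ (hw.transport_mem_ces hv (measurable_const (a := (1 : ℝ))) (C := 1) (by simp))
    refine lt_of_le_of_lt (le_of_eq (lintegral_congr_ae ?_)) h1
    filter_upwards [hw.transport_ae_eq _ (measurable_const (a := (1 : ℝ))), hvt] with t h2 h3
    rw [h2, one_mul, h3.2.1]
  have hgfin : ∀ᵐ t, (g t).abs < ∞ := by
    have hm : AEMeasurable (fun t => (v t * g t).abs) := by
      simp only [EReal.abs_mul]
      exact (measurable_abs.comp_aemeasurable hw.aemeasurable).mul
        (measurable_abs.comp g.measurable).aemeasurable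
    filter_upwards [ae_lt_top' hm hvg.ne, hvt] with t h1 h2
    rw [EReal.abs_mul, h2.2.2.2, ← h2.2.2.1] at h1
    exact ENNReal.lt_top_of_mul_ne_top_right h1.ne (by simpa using h2.1)
  set K := weakAssociateNorm (Ces w) (alteredNorm w) g with hK
  have hKfin : K ≠ ∞ := hg.2.ne
  set N := K.toReal with hN
  have hNK : ENNReal.ofReal N = K := ENNReal.ofReal_toReal hKfin
  obtain ⟨G, hGm, hGg⟩ := (hw.measurableEmbedding_primitive hv).exists_measurable_extend
    (measurable_ereal_toReal.comp g.measurable) (fun _ => ⟨(0 : ℝ)⟩)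
  have hGg : ∀ t, G (primitive v t) = (g t).toReal := fun t => congrFun hGg t
  have hGl : ∫⁻ y in Ioi 0, ‖G y‖ₑ = l1Norm (fun x => v x * g x) := by
    rw [← hw.lintegral_comp_primitive hv]
    refine lintegral_congr_ae ?_
    filter_upwards [hgfin, hvt] with t h1 h2
    rw [hGg, EReal.abs_mul, h2.2.2.2, EReal.abs_eq_enorm_toReal h1]
  have hGi : IntegrableOn G (Ioi 0) := ⟨hGm.aestronglyMeasurable, by
    rw [hasFiniteIntegral_iff_enorm, hGl]; exact hvg⟩
  have H : ∀ p : ℝ → ℝ, Measurable p → (∃ C, ∀ t, |p t| ≤ C) →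
      (∀ y > 0, |∫ t in Ioc 0 y, p t| ≤ y) → |∫ t in Ioi 0, p t * G t| ≤ N := by
    rintro p hp ⟨C, hC⟩ hpF
    have h1 := enorm_integral_le_of_alteredNorm_le_one (g := g) (hw.transport_mem_ces hv hp hC)
      (hw.alteredNorm_transport_le hv hp hpF)
    have h2 : ∫ x, (hw.transport p hp x * g x).toReal = ∫ t in Ioi 0, p t * G t := by
      rw [← hw.integral_comp_primitive hv]
      refine integral_congr_ae ((hw.transport_ae_eq p hp).mono fun t ht => ?_)
      dsimp only
      rw [ht, EReal.toReal_mul, EReal.toReal_coe, hGg]; ring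
    rw [h2, ← hK, ← hNK, ← ofReal_norm, Real.norm_eq_abs,
      ENNReal.ofReal_le_ofReal_iff ENNReal.toReal_nonneg] at h1
    exact h1
  have Hc := abs_linearCombination_le hGi H
  have hE := hw.ae_of_ae_half_line hv (ae_mem_rightLebesguePoints hGi)
  refine ⟨hgfin, ?_, ⟨primitive v ⁻¹' rightLebesguePoints G, hE, ?_⟩, ?_⟩
  · rw [← hGl, ← hNK]
    exact lintegral_enorm_le hGm hGi H
  · have h1 := (eVariationOn.comp_le_of_monotoneOn (fun y => y * G y) (primitive v)
      ((hw.strictMono_primitive hv).monotone.monotoneOn _)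
      (mapsTo_preimage _ (rightLebesguePoints G))).trans (eVariationOn_mul_le Hc)
    rw [ENNReal.ofReal_mul zero_le_two, hNK, ENNReal.ofReal_ofNat] at h1
    simpa only [Function.comp_def, hGg] using h1
  · rw [← hNK]
    refine le_trans ?_ (lintegral_iSup_rightLebesguePoints_le hGi Hc)
    rw [← hw.lintegral_comp_primitive hv]
    refine lintegral_mono fun t => ?_
    gcongr
    refine essSup_le_of_ae_le _ ?_
    have hne : ∀ᵐ s ∂(volume : Measure (interval c d)), s ≠ t := by simp [ae_iff, measure_singleton]
    filter_upwards [ae_restrict_of_ae hE, ae_restrict_of_ae hgfin, ae_restrict_of_ae hne,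
      ae_restrict_mem measurableSet_Ici] with s h1 h2 h3 h4
    have h5 : primitive v t < primitive v s :=
      hw.strictMono_primitive hv (lt_of_le_of_ne h4 (Ne.symm h3))
    rw [EReal.abs_eq_enorm_toReal h2, ← hGg]
    refine le_iSup₂_of_le (primitive v s) h1 ?_
    rw [indicator_of_mem (show primitive v t ∈ Iio (primitive v s) from h5)]

lemma IsBPVRep.ae_eq_mul (hw : IsWeight v w) {g : L0 c d} {h : interval c d → ℝ}
    (hh : IsBPVRep w g h) : ∀ᵐ t, h t = primitive v t * (g t).toReal :=
  hh.ae_eq.mono fun t ht => by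
    have := congrArg EReal.toReal ht
    rwa [EReal.toReal_coe, EReal.toReal_mul, EReal.toReal_coe, hw.eq_inv, inv_inv] at this

lemma IsWeight.exists_isBPVRep (hw : IsWeight v w) {g : L0 c d} (hgfin : ∀ᵐ t, (g t).abs < ∞)
    {E : Set (interval c d)} (hE : ∀ᵐ t, t ∈ E)
    (hb : BoundedVariationOn (fun t => primitive v t * (g t).toReal) E) :
    ∃ h, IsBPVRep w g h := by
  obtain ⟨h, hh, heq⟩ := exists_boundedVariationOn_extension hb
  refine ⟨h, hh, ?_⟩
  filter_upwards [hgfin, hE] with t h1 h2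
  rw [← heq h2, EReal.coe_mul, EReal.coe_toReal_of_abs_lt_top h1, hw.eq_inv, inv_inv]

/-- The total variation of `λ_h` only depends on `h` almost everywhere. -/
lemma IsBPVRep.lambdaNorm_le (hw : IsWeight v w) [Nonempty (interval c d)] {g : L0 c d}
    {h : interval c d → ℝ} (hh : IsBPVRep w g h) {E : Set (interval c d)} (hE : ∀ᵐ t, t ∈ E) :
    lambdaNorm hh.bpv ≤ eVariationOn (fun t => primitive v t * (g t).toReal) E := by
  have hd : Dense {t | t ∈ E ∧ h t = primitive v t * (g t).toReal} :=
    Measure.dense_of_ae (hE.and (hh.ae_eq_mul hw))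
  calc lambdaNorm hh.bpv ≤ eVariationOn h.rightLim univ := variation_vectorMeasure_univ_le hh.bpv
    _ ≤ eVariationOn h {t | t ∈ E ∧ h t = primitive v t * (g t).toReal} :=
        eVariationOn_rightLim_le_of_dense hh.bpv hd
    _ = eVariationOn (fun t => primitive v t * (g t).toReal)
          {t | t ∈ E ∧ h t = primitive v t * (g t).toReal} :=
        eVariationOn.congr fun t ht => ht.2
    _ ≤ _ := eVariationOn.mono _ fun t ht => ht.1

end Transfer

/-! ### Decreasing majorants -/

section Domination

variable {α : Type*} [LinearOrder α] [TopologicalSpace α] [OrderTopology α] [MeasurableSpace α]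
  [SecondCountableTopology α] [DenselyOrdered α]

/-- If one atomless measure is dominated by another measure on all initial rays, then it is
dominated on all initial segments. -/
lemma measure_le_of_isLowerSet {m₁ m₂ : Measure α} [NullSingletonClass m₁]
    (h : ∀ x, m₁ (Iio x) ≤ m₂ (Iio x)) {s : Set α} (hs : IsLowerSet s) : m₁ s ≤ m₂ s := by
  by_cases hmax : ∃ b, IsGreatest s b
  · obtain ⟨b, hb⟩ := hmax
    calc m₁ s ≤ m₁ (Iic b) := measure_mono hb.2
      _ = m₁ (Iio b) := (measure_congr Iio_ae_eq_Iic).symm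
      _ ≤ m₂ (Iio b) := h b
      _ ≤ m₂ s := measure_mono fun x hx => hs (le_of_lt hx) hb.1
  · obtain ⟨D, hD, hDd⟩ := TopologicalSpace.exists_countable_dense α
    have h1 : s ⊆ ⋃ b ∈ D ∩ s, Iio b := by
      intro x hx
      have : ∃ y ∈ s, x < y := by
        by_contra! h'
        exact hmax ⟨x, hx, h'⟩
      obtain ⟨y, hy, hxy⟩ := this
      obtain ⟨z, hz, hzD⟩ := hDd.inter_open_nonempty _ isOpen_Ioo (nonempty_Ioo.2 hxy)
      exact mem_iUnion₂.2 ⟨z, ⟨hzD, hs hz.2.le hy⟩, hz.1⟩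
    refine (measure_mono h1).trans ?_
    rw [measure_biUnion_eq_iSup (hD.mono inter_subset_left)]
    · exact iSup₂_le fun b hb =>
        (h b).trans (measure_mono fun x hx => hs (le_of_lt hx) hb.2)
    · intro a ha b hb
      rcases le_total a b with hab | hab
      · exact ⟨b, hb, Iio_subset_Iio hab, subset_rfl⟩
      · exact ⟨a, ha, subset_rfl, Iio_subset_Iio hab⟩

/-- Domination on initial rays gives domination of the integrals of decreasing functions, by the
layer cake formula. -/
lemma lintegral_le_of_antitone [BorelSpace α] {m₁ m₂ : Measure α} [NullSingletonClass m₁]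
    (h : ∀ x, m₁ (Iio x) ≤ m₂ (Iio x)) {f : α → ℝ} (hf : Antitone f) (hf0 : ∀ x, 0 ≤ f x) :
    ∫⁻ x, ENNReal.ofReal (f x) ∂m₁ ≤ ∫⁻ x, ENNReal.ofReal (f x) ∂m₂ := by
  rw [lintegral_eq_lintegral_meas_lt _ (ae_of_all _ hf0) hf.measurable.aemeasurable,
    lintegral_eq_lintegral_meas_lt _ (ae_of_all _ hf0) hf.measurable.aemeasurable]
  exact lintegral_mono fun t =>
    measure_le_of_isLowerSet h fun x y hyx hx => lt_of_lt_of_le hx (hf hyx)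

end Domination

/-- A function of bounded variation has only countably many discontinuities, so it agrees almost
everywhere with its right limits. -/
lemma ae_rightLim_eq {α : Type*} [LinearOrder α] [TopologicalSpace α] [OrderTopology α]
    [DenselyOrdered α] [NoMaxOrder α] [SecondCountableTopology α] [MeasurableSpace α]
    {μ : Measure α} [NullSingletonClass μ] {h : α → ℝ} (hh : BoundedVariationOn h univ) :
    ∀ᵐ x ∂μ, h.rightLim x = h x := by
  obtain ⟨p, q, hp, hq, rfl⟩ := hh.locallyBoundedVariationOn.exists_monotoneOn_sub_monotoneOn
  rw [monotoneOn_univ] at hp hq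
  have h1 := hp.countable_not_continuousAt.ae_notMem μ
  have h2 := hq.countable_not_continuousAt.ae_notMem μ
  filter_upwards [h1, h2] with x hx1 hx2
  have h3 : ContinuousAt (p - q) x := (not_not.1 hx1).sub (not_not.1 hx2)
  exact rightLim_eq_of_tendsto (h3.mono_left nhdsWithin_le_nhds)

section Majorant

variable {c d : EReal} {v : interval c d → EReal} {w : interval c d → ℝ}

/-- The decreasing function `t ↦ ‖g‖_{L^∞([t, d))}`. -/
def tailSup (g : L0 c d) (t : interval c d) : ℝ≥0∞ :=
  essSup (fun x => (g x).abs) (volume.restrict (Ici t))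

lemma antitone_tailSup (g : L0 c d) : Antitone (tailSup g) := fun _ _ hst =>
  essSup_mono_measure (Measure.absolutelyContinuous_of_le
    (Measure.restrict_mono (Ici_subset_Ici.2 hst) le_rfl))

lemma IsWeight.tailSup_lt_top (hw : IsWeight v w) (hv : ∀ᵐ t, 0 < v t) {g : L0 c d}
    (hS : ∫⁻ t, (v t).toENNReal * tailSup g t < ∞) (t : interval c d) : tailSup g t < ∞ := by
  refine lt_top_iff_ne_top.2 fun h => hS.ne (top_le_iff.1 ?_)
  calc ∞ = (∫⁻ s in Iio t, (v s).toENNReal) * ∞ := by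
        rw [ENNReal.mul_top]
        have := hw.weightMeasure_Iio hv t
        rw [weightMeasure, withDensity_apply _ measurableSet_Iio] at this
        rw [this]; simpa using hw.primitive_pos t
    _ = ∫⁻ s in Iio t, (v s).toENNReal * ∞ := by
        rw [lintegral_mul_const'' _ hw.aemeasurable_toENNReal.restrict]
    _ ≤ ∫⁻ s in Iio t, (v s).toENNReal * tailSup g s := by
        refine setLIntegral_mono' measurableSet_Iio fun s hs => ?_
        gcongr
        exact h.symm.le.trans (antitone_tailSup g (le_of_lt hs))
    _ ≤ _ := setLIntegral_le_lintegral _ _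

/-- The essential supremum defining `rho` is a genuine supremum. -/
lemma IsWeight.abs_primitive_le (hw : IsWeight v w) {f : interval c d → EReal} (hf : LocallyL1 f)
    (hfm : AEMeasurable f) (hfin : rho w f < ∞) (x : interval c d) :
    |primitive f x| ≤ (rho w f).toReal * primitive v x := by
  have hcl : IsClosed {x | |primitive f x| ≤ (rho w f).toReal * primitive v x} :=
    isClosed_le (hf.continuous_primitive hfm).abs (hw.continuous_primitive.const_mul _)
  have hd : Dense {x | |primitive f x| ≤ (rho w f).toReal * primitive v x} := by
    refine Measure.dense_of_ae (μ := volume) ?_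
    have h1 : ∀ᵐ x, ‖w x * primitive f x‖ₑ ≤ rho w f := ENNReal.ae_le_essSup _
    filter_upwards [h1] with x hx
    have hV := hw.primitive_pos x
    rw [hw.eq_inv, ← ENNReal.ofReal_toReal hfin.ne, ← ofReal_norm, Real.norm_eq_abs, abs_mul,
      abs_of_pos (inv_pos.2 hV), ENNReal.ofReal_le_ofReal_iff ENNReal.toReal_nonneg,
      inv_mul_le_iff₀ hV, mul_comm] at hx
    exact hx
  exact hcl.closure_subset_iff.2 subset_rfl (hd x)

/-- For `f` in the Cesàro space the measure `|f| dx` is dominated on initial rays by a multiple of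
`v dx`, and therefore integrates every weighted integrable decreasing function. -/
theorem IsWeight.lintegral_abs_mul_tailSup_lt_top (hw : IsWeight v w) (hv : ∀ᵐ t, 0 < v t)
    {g : L0 c d} (hS : ∫⁻ t, (v t).toENNReal * tailSup g t < ∞) {f : L0 c d} (hf : f ∈ Ces w) :
    ∫⁻ t, (f t).abs * tailSup g t < ∞ := by
  set K := (cesNorm w f).toReal
  have hfm : Measurable fun t => (f t).abs := measurable_abs.comp f.measurable
  have hffin := hf.1.ae_abs_lt_top f.measurable.aemeasurable
  have hloc : LocallyL1 fun t => ((f t).abs : EReal) := fun x => by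
    refine lt_of_le_of_lt (le_of_eq ?_) (hf.1 x)
    exact lintegral_congr fun t => by
      rw [EReal.abs_eq_toENNReal (EReal.coe_ennreal_nonneg _), EReal.toENNReal_coe]
  have h1 : ∀ x, (volume.withDensity fun t => (f t).abs) (Iio x) ≤
      (ENNReal.ofReal K • weightMeasure v) (Iio x) := by
    intro x
    have h2 := hw.abs_primitive_le hloc
      (measurable_coe_ennreal_ereal.comp hfm).aemeasurable hf.2 x
    have h3 : primitive (fun t => ((f t).abs : EReal)) x = (∫⁻ t in Iio x, (f t).abs).toReal := by
      rw [primitive, ← integral_toReal hfm.aemeasurable (ae_restrict_of_ae hffin)]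
      exact integral_congr_ae (ae_of_all _ fun t => EReal.toReal_coe_ennreal)
    rw [withDensity_apply _ measurableSet_Iio, Measure.smul_apply, hw.weightMeasure_Iio hv,
      smul_eq_mul, ← ENNReal.ofReal_mul ENNReal.toReal_nonneg,
      ← ENNReal.ofReal_toReal (hf.1 x).ne, ← h3]
    exact ENNReal.ofReal_le_ofReal ((le_abs_self _).trans h2)
  have hfin := hw.tailSup_lt_top hv hS
  have hanti : Antitone fun t => (tailSup g t).toReal := fun s t hst =>
    ENNReal.toReal_mono (hfin s).ne (antitone_tailSup g hst)
  have h2 := lintegral_le_of_antitone h1 hanti fun _ => ENNReal.toReal_nonneg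
  simp only [ENNReal.ofReal_toReal (hfin _).ne] at h2
  rw [lintegral_withDensity_eq_lintegral_mul _ hfm (antitone_tailSup g).measurable,
    lintegral_smul_measure, weightMeasure,
    lintegral_withDensity_eq_lintegral_mul₀ hw.aemeasurable_toENNReal
      (antitone_tailSup g).measurable.aemeasurable] at h2
  exact h2.trans_lt (ENNReal.mul_lt_top ENNReal.ofReal_lt_top hS)

/-- A right-continuous representative of `g` is bounded by the tail supremum at every point. -/
lemma enorm_le_tailSup {g : L0 c d} {γ : interval c d → ℝ}
    (hγ : ∀ x, ContinuousWithinAt γ (Ici x) x) (hae : ∀ᵐ t, (g t).abs = ‖γ t‖ₑ)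
    {s t : interval c d} (hst : s ≤ t) : ‖γ t‖ₑ ≤ tailSup g s := by
  by_contra! hlt
  have h1 : ∀ᶠ x in 𝓝[>] t, tailSup g s < ‖γ x‖ₑ := by
    have := ((hγ t).mono Ioi_subset_Ici_self).enorm
    exact (tendsto_order.1 this).1 _ hlt
  obtain ⟨b, hb, hbs⟩ := mem_nhdsGT_iff_exists_Ioo_subset.1 h1
  have h2 : ∀ᵐ x, x ∈ Ici s → (g x).abs ≤ tailSup g s :=
    (ae_restrict_iff' measurableSet_Ici).1 (ENNReal.ae_le_essSup _)
  obtain ⟨x, hx, h3, h4⟩ := (Measure.dense_of_ae (h2.and hae)).inter_open_nonempty _ isOpen_Ioo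
    (nonempty_Ioo.2 hb)
  have h5 := h3 (hst.trans hx.1.le)
  rw [h4] at h5
  exact absurd (hbs hx) (not_lt.2 h5)

end Majorant

/-! ### Step functions on the level sets of the weight and the upper bound -/

/-- Summation by parts for a step function with values `a j` on the cells of a grid of mesh `δ`,
against increments of a function `Φ` bounded by `M` times the identity. -/
lemma abs_sum_mul_sub_le {a Φ : ℕ → ℝ} {M δ : ℝ} (hδ : 0 ≤ δ) (hΦ0 : Φ 0 = 0)
    (hΦ : ∀ j : ℕ, |Φ j| ≤ M * (j * δ)) (hM : 0 ≤ M) (m : ℕ) :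
    |∑ j ∈ Finset.range (m + 1), a j * (Φ (j + 1) - Φ j)| ≤
      M * (∑ j ∈ Finset.range m, |((j + 1 : ℕ) + 1) * δ * a (j + 1) - (j + 1) * δ * a j| +
        |(m + 1) * δ * a m| + δ * ∑ j ∈ Finset.range (m + 1), |a j|) := by
  have h1 : ∀ m, ∑ j ∈ Finset.range (m + 1), a j * (Φ (j + 1) - Φ j) =
      a m * Φ (m + 1) + ∑ j ∈ Finset.range m, (a j - a (j + 1)) * Φ (j + 1) := by
    intro m
    induction m with
    | zero => simp [hΦ0]
    | succ m ih => rw [Finset.sum_range_succ, ih, Finset.sum_range_succ _ m]; ring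
  have h2 : |a m * Φ (m + 1)| ≤ M * |(m + 1) * δ * a m| := by
    rw [abs_mul, abs_mul, abs_of_nonneg (by positivity : (0 : ℝ) ≤ (m + 1) * δ)]
    have := mul_le_mul_of_nonneg_left (hΦ (m + 1)) (abs_nonneg (a m))
    push_cast at this
    linarith
  have h3 : ∀ j : ℕ, |(a j - a (j + 1)) * Φ (j + 1)| ≤
      M * |((j + 1 : ℕ) + 1) * δ * a (j + 1) - (j + 1) * δ * a j| + M * (δ * |a (j + 1)|) := by
    intro j
    rw [abs_mul, ← mul_add]
    have h4 := mul_le_mul_of_nonneg_left (hΦ (j + 1)) (abs_nonneg (a j - a (j + 1)))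
    have h5 : (j + 1) * δ * |a j - a (j + 1)| ≤
        |((j + 1 : ℕ) + 1) * δ * a (j + 1) - (j + 1) * δ * a j| + δ * |a (j + 1)| := by
      have h6 : (0 : ℝ) ≤ (j + 1) * δ := by positivity
      calc (j + 1) * δ * |a j - a (j + 1)| = |(j + 1) * δ * (a j - a (j + 1))| := by
            rw [abs_mul, abs_of_nonneg h6]
        _ = |-(((j + 1 : ℕ) + 1) * δ * a (j + 1) - (j + 1) * δ * a j) + δ * a (j + 1)| := by
            push_cast; congr 1; ring
        _ ≤ _ := by
            refine (abs_add_le _ _).trans ?_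
            rw [abs_neg, abs_mul δ, abs_of_nonneg hδ]
    have h7 := mul_le_mul_of_nonneg_left h5 hM
    push_cast at h4 h7 ⊢
    linarith
  have h4 : ∑ j ∈ Finset.range m, δ * |a (j + 1)| ≤ δ * ∑ j ∈ Finset.range (m + 1), |a j| := by
    rw [← Finset.mul_sum, Finset.sum_range_succ' _ m]
    exact mul_le_mul_of_nonneg_left (le_add_of_nonneg_right (abs_nonneg _)) hδ
  rw [h1]
  calc _ ≤ M * |(m + 1) * δ * a m| + ∑ j ∈ Finset.range m,
        (M * |((j + 1 : ℕ) + 1) * δ * a (j + 1) - (j + 1) * δ * a j| + M * (δ * |a (j + 1)|)) :=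
        (abs_add_le _ _).trans (add_le_add h2 ((Finset.abs_sum_le_sum_abs _ _).trans
          (Finset.sum_le_sum fun j _ => h3 j)))
    _ ≤ _ := by
        rw [Finset.sum_add_distrib, ← Finset.mul_sum, ← Finset.mul_sum]
        have := mul_le_mul_of_nonneg_left h4 hM
        linarith

section Grid

variable {c d : EReal} {v : interval c d → EReal} {w : interval c d → ℝ}

/-- The step function with the value `a j` on the cell `{j δ < V ≤ (j + 1) δ}` for `j ≤ m`, and
`0` elsewhere. -/
def gridStep (V : interval c d → ℝ) (δ : ℝ) (m : ℕ) (a : ℕ → ℝ) (t : interval c d) : ℝ :=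
  ∑ j ∈ Finset.range (m + 1), (V ⁻¹' Ioc (j * δ) ((j + 1) * δ)).indicator (fun _ => a j) t

lemma exists_gridStep_eq {V : interval c d → ℝ} {δ : ℝ} (hδ : 0 < δ) {t : interval c d}
    (ht : 0 < V t) :
    ∃ k : ℕ, k * δ < V t ∧ V t ≤ (k + 1) * δ ∧
      ∀ m a, gridStep V δ m a t = if k < m + 1 then a k else 0 := by
  have h0 : 0 < V t / δ := div_pos ht hδ
  obtain ⟨k, hk⟩ : ∃ k, ⌈V t / δ⌉₊ = k + 1 := Nat.exists_eq_succ_of_ne_zero (Nat.ceil_pos.2 h0).ne'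
  have h1 : (k : ℝ) * δ < V t := by
    rw [← lt_div_iff₀ hδ, ← Nat.lt_ceil, hk]; exact k.lt_succ_self
  have h2 : V t ≤ (k + 1) * δ := by
    have := Nat.le_ceil (V t / δ)
    rw [hk, div_le_iff₀ hδ] at this
    exact_mod_cast this
  have h3 : ∀ j : ℕ, j ≠ k → t ∉ V ⁻¹' Ioc (j * δ) ((j + 1) * δ) := by
    rintro j hjk ⟨h4, h5⟩
    have h6 : (j : ℝ) < k + 1 := lt_of_mul_lt_mul_right (h4.trans_le h2) hδ.le
    have h7 : (k : ℝ) < j + 1 := lt_of_mul_lt_mul_right (h1.trans_le h5) hδ.le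
    have h8 : j < k + 1 := by exact_mod_cast h6
    have h9 : k < j + 1 := by exact_mod_cast h7
    omega
  refine ⟨k, h1, h2, fun m a => ?_⟩
  rw [gridStep]
  split_ifs with hkm
  · rw [Finset.sum_eq_single_of_mem k (Finset.mem_range.2 hkm)
      fun j _ hj => indicator_of_notMem (h3 j hj) _]
    exact indicator_of_mem (show t ∈ V ⁻¹' Ioc (k * δ) ((k + 1) * δ) from ⟨h1, h2⟩) _
  · refine Finset.sum_eq_zero fun j hj => indicator_of_notMem (h3 j ?_) _
    rintro rfl
    exact hkm (Finset.mem_range.1 hj)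

lemma measurable_gridStep {V : interval c d → ℝ} (hV : Measurable V) (δ : ℝ) (m : ℕ) (a : ℕ → ℝ) :
    Measurable (gridStep V δ m a) :=
  Finset.measurable_sum _ fun _ _ => measurable_const.indicator (hV measurableSet_Ioc)

lemma IsWeight.setIntegral_preimage_Iic (hw : IsWeight v w) (hv : ∀ᵐ t, 0 < v t)
    (φ : interval c d → ℝ) (x : interval c d) :
    ∫ t in primitive v ⁻¹' Iic (primitive v x), φ t = ∫ t in Iio x, φ t := by
  have : primitive v ⁻¹' Iic (primitive v x) = Iic x := by
    ext t; simp [(hw.strictMono_primitive hv).le_iff_le]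
  rw [this]
  exact (setIntegral_congr_set Iio_ae_eq_Iic).symm

lemma IsWeight.integral_mul_gridStep (hw : IsWeight v w) (hv : ∀ᵐ t, 0 < v t)
    [Nonempty (interval c d)] {φ : interval c d → ℝ} (hφ : ∀ x, IntegrableOn φ (Iio x))
    {δ : ℝ} (hδ : 0 < δ) (m : ℕ) (a : ℕ → ℝ) :
    ∫ t, φ t * gridStep (primitive v) δ m a t = ∑ j ∈ Finset.range (m + 1), a j *
      ((∫ t in primitive v ⁻¹' Iic ((j + 1 : ℕ) * δ), φ t) -
        ∫ t in primitive v ⁻¹' Iic (j * δ), φ t) := by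
  have hVm := hw.continuous_primitive.measurable
  have hint : ∀ y, IntegrableOn φ (primitive v ⁻¹' Iic y) := by
    intro y
    rcases le_or_gt y 0 with h | h
    · have : primitive v ⁻¹' Iic y = ∅ := eq_empty_of_forall_notMem fun x hx =>
        absurd (hw.primitive_pos x) (not_lt.2 (le_trans hx h))
      rw [this]; exact integrableOn_empty
    · obtain ⟨b, hb⟩ := (hw.tendsto.eventually (eventually_gt_atTop y)).exists
      refine (hφ b).mono_set fun x hx => ?_
      exact (hw.strictMono_primitive hv).lt_iff_lt.1 (lt_of_le_of_lt hx hb)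
  have hcell : ∀ j : ℕ, primitive v ⁻¹' Ioc (j * δ) ((j + 1) * δ) =
      primitive v ⁻¹' Iic ((j + 1 : ℕ) * δ) \ primitive v ⁻¹' Iic (j * δ) := fun j => by
    ext t; simp [and_comm]
  have h1 : ∀ j : ℕ, ∀ t, φ t * (primitive v ⁻¹' Ioc (j * δ) ((j + 1) * δ)).indicator
      (fun _ => a j) t = a j * (primitive v ⁻¹' Ioc (j * δ) ((j + 1) * δ)).indicator φ t := by
    intro j t
    by_cases h : t ∈ primitive v ⁻¹' Ioc (j * δ) ((j + 1) * δ)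
    · rw [indicator_of_mem h, indicator_of_mem h, mul_comm]
    · rw [indicator_of_notMem h, indicator_of_notMem h, mul_zero, mul_zero]
  have h2 : ∀ j : ℕ, IntegrableOn φ (primitive v ⁻¹' Ioc (j * δ) ((j + 1) * δ)) := fun j => by
    rw [hcell]; exact (hint _).mono_set sdiff_subset
  simp only [gridStep, Finset.mul_sum, h1]
  rw [integral_finsetSum _ fun j _ =>
    ((integrable_indicator_iff (hVm measurableSet_Ioc)).2 (h2 j)).const_mul _]
  refine Finset.sum_congr rfl fun j _ => ?_
  rw [integral_const_mul, integral_indicator (hVm measurableSet_Ioc), hcell,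
    setIntegral_sdiff (hVm measurableSet_Iic) (hint _)]
  refine preimage_mono (Iic_subset_Iic.2 ?_)
  push_cast; nlinarith

/-- A limit at `d` of a function `u` with `∫ v |u| / V < ∞` vanishes, since `∫ v / V` diverges
there. -/
lemma IsWeight.eq_zero_of_tendsto (hw : IsWeight v w) (hv : ∀ᵐ t, 0 < v t)
    [Nonempty (interval c d)] {u : interval c d → ℝ} {l : ℝ} (hu : Tendsto u atTop (𝓝 l))
    (hfin : ∫⁻ t, (v t).toENNReal * ‖u t / primitive v t‖ₑ < ∞) : l = 0 := by
  by_contra hl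
  have hε : 0 < |l| / 2 := by positivity
  obtain ⟨a, ha⟩ := eventually_atTop.1
    ((tendsto_order.1 hu.abs).1 (|l| / 2) (half_lt_self (abs_pos.2 hl)))
  set q : ℝ → ℝ≥0∞ := (Ioi (primitive v a)).indicator fun y => ENNReal.ofReal (|l| / 2 * y⁻¹)
  have h1 : ∫⁻ t, (v t).toENNReal * q (primitive v t) < ∞ := by
    refine lt_of_le_of_lt (lintegral_mono fun t => ?_) hfin
    gcongr
    by_cases h : primitive v a < primitive v t
    · have hat : a ≤ t := ((hw.strictMono_primitive hv).lt_iff_lt.1 h).le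
      have hV := hw.primitive_pos t
      simp only [q]
      rw [indicator_of_mem (show primitive v t ∈ Ioi (primitive v a) from h), ← ofReal_norm,
        Real.norm_eq_abs, abs_div, abs_of_pos hV, div_eq_mul_inv]
      refine ENNReal.ofReal_le_ofReal (mul_le_mul_of_nonneg_right (ha t hat).le ?_)
      exact inv_nonneg.2 hV.le
    · simp only [q]
      rw [indicator_of_notMem (show primitive v t ∉ Ioi (primitive v a) from h)]
      exact zero_le
  rw [hw.lintegral_comp_primitive hv, ← lintegral_indicator measurableSet_Ioi,
    indicator_indicator, inter_eq_right.2 (Ioi_subset_Ioi (hw.primitive_pos a).le),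
    lintegral_indicator measurableSet_Ioi] at h1
  have h2 : IntegrableOn (fun y : ℝ => |l| / 2 * y⁻¹) (Ioi (primitive v a)) := by
    refine ⟨(measurable_inv.const_mul _).aestronglyMeasurable, ?_⟩
    rw [hasFiniteIntegral_iff_ofReal]
    · exact h1
    · filter_upwards [ae_restrict_mem measurableSet_Ioi] with y hy
      have : 0 < y := (hw.primitive_pos a).trans hy
      simp only [Pi.zero_apply]; positivity
  have h3 := h2.const_mul (|l| / 2)⁻¹
  simp only [← mul_assoc, inv_mul_cancel₀ hε.ne', one_mul] at h3
  exact not_integrableOn_Ioi_inv h3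

end Grid

section UpperBound

variable {c d : EReal} {v : interval c d → EReal} {w : interval c d → ℝ}

lemma lambdaNorm_ne_top [Nonempty (interval c d)] {u : interval c d → ℝ}
    (hu : BoundedVariationOn u univ) : lambdaNorm hu ≠ ∞ :=
  ((variation_vectorMeasure_univ_le hu).trans_lt hu.rightLim.lt_top).ne

/-- Integration by parts on a grid: against a step function with the values of `û / V` at the right
end points of the cells, where `û` is the right-limit function of `u`, the integral of `f` is
controlled by the altered norm of `f`. -/
lemma IsWeight.abs_integral_mul_gridStep_le (hw : IsWeight v w) (hv : ∀ᵐ t, 0 < v t)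
    [Nonempty (interval c d)] {f : L0 c d} (hf : LocallyL1 f) (hfin : alteredNorm w f < ∞)
    {u : interval c d → ℝ} (hu : BoundedVariationOn u univ) {δ : ℝ} (hδ : 0 < δ)
    {τ : ℕ → interval c d} (hτ : ∀ j : ℕ, primitive v (τ j) = (j + 1) * δ) (m : ℕ) :
    |∫ t, (f t).toReal * gridStep (primitive v) δ m
        (fun j => u.rightLim (τ j) / primitive v (τ j)) t| ≤
      (alteredNorm w f).toReal * ((lambdaNorm hu).toReal + |u.rightLim (τ m)| +
        ∫ t, (v t).toReal * |gridStep (primitive v) δ m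
          (fun j => u.rightLim (τ j) / primitive v (τ j)) t|) := by
  set a : ℕ → ℝ := fun j => u.rightLim (τ j) / primitive v (τ j) with ha
  set M := (alteredNorm w f).toReal with hM
  have hfm : AEMeasurable (f : interval c d → EReal) := f.measurable.aemeasurable
  have hmul : ∀ j : ℕ, ((j : ℝ) + 1) * δ * a j = u.rightLim (τ j) := fun j => by
    rw [← hτ j, ha, mul_div_cancel₀ _ (hw.primitive_pos _).ne']
  have hempty : primitive v ⁻¹' Iic (((0 : ℕ) : ℝ) * δ) = ∅ :=
    eq_empty_of_forall_notMem fun x hx =>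
      absurd (hw.primitive_pos x) (not_lt.2 (by simpa using hx))
  have hpre : ∀ (φ : interval c d → ℝ) (j : ℕ),
      ∫ t in primitive v ⁻¹' Iic (((j + 1 : ℕ) : ℝ) * δ), φ t = ∫ t in Iio (τ j), φ t :=
    fun φ j => by
      rw [← hw.setIntegral_preimage_Iic hv φ (τ j), hτ j]; push_cast; rfl
  have hVj : ∀ j : ℕ, ∫ t in primitive v ⁻¹' Iic ((j : ℝ) * δ), (v t).toReal = j * δ := by
    intro j
    cases j with
    | zero => rw [hempty]; simp
    | succ j => rw [hpre]; push_cast; exact hτ j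
  have hΦ : ∀ j : ℕ, |∫ t in primitive v ⁻¹' Iic ((j : ℝ) * δ), (f t).toReal| ≤ M * (j * δ) := by
    intro j
    cases j with
    | zero => rw [hempty]; simp
    | succ j =>
      rw [hpre]
      have := hw.abs_primitive_le hf hfm hfin (τ j)
      rw [hτ] at this
      push_cast
      exact this
  -- the absolute value of the step function is the step function of the absolute values
  have habs : ∀ t, |gridStep (primitive v) δ m a t| =
      gridStep (primitive v) δ m (fun j => |a j|) t := fun t => by
    obtain ⟨k, _, _, hk⟩ := exists_gridStep_eq hδ (hw.primitive_pos t)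
    rw [hk, hk]; split_ifs <;> simp
  have hint : ∫ t, (v t).toReal * |gridStep (primitive v) δ m a t| =
      δ * ∑ j ∈ Finset.range (m + 1), |a j| := by
    simp only [habs]
    rw [hw.integral_mul_gridStep hv (hw.locallyL1.integrableOn hw.aemeasurable) hδ, Finset.mul_sum]
    refine Finset.sum_congr rfl fun j _ => ?_
    rw [hVj, hVj]; push_cast; ring
  have hτmono : Monotone τ := fun i j hij => by
    rw [← (hw.strictMono_primitive hv).le_iff_le, hτ, hτ]
    have : (i : ℝ) ≤ j := by exact_mod_cast hij
    gcongr
  have hlam := lambdaNorm_ne_top hu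
  have hvar : ∑ j ∈ Finset.range m, |u.rightLim (τ (j + 1)) - u.rightLim (τ j)| ≤
      (lambdaNorm hu).toReal := by
    have h1 := sum_abs_rightLim_le hu hτmono m
    rw [← ENNReal.ofReal_sum_of_nonneg fun _ _ => abs_nonneg _] at h1
    exact (ENNReal.ofReal_le_iff_le_toReal hlam).1 h1
  have key := abs_sum_mul_sub_le (a := a) hδ.le
    (Φ := fun j => ∫ t in primitive v ⁻¹' Iic ((j : ℝ) * δ), (f t).toReal)
    (by rw [hempty]; simp) hΦ ENNReal.toReal_nonneg m
  simp only [hmul] at key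
  rw [hw.integral_mul_gridStep hv (hf.integrableOn hfm) hδ, hint]
  refine key.trans (mul_le_mul_of_nonneg_left ?_ ENNReal.toReal_nonneg)
  linarith

lemma IsBPVRep.ae_abs_lt_top {g : L0 c d} {h : interval c d → ℝ} (hw : IsWeight v w)
    (hh : IsBPVRep w g h) : ∀ᵐ t, (g t).abs < ∞ := by
  filter_upwards [hh.ae_eq] with t ht
  have h1 := congrArg EReal.abs ht
  rw [EReal.abs_mul, EReal.abs_def, EReal.abs_def] at h1
  refine ENNReal.lt_top_of_mul_ne_top_right (h1 ▸ ENNReal.ofReal_ne_top) ?_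
  have := inv_pos.2 (hw.pos t)
  simpa using this.ne'

/-- Dividing the right limits of a representative of `g / w` by `V` gives a right-continuous
representative of `g`. -/
lemma IsBPVRep.ae_rightLim_div_eq (hw : IsWeight v w) {g : L0 c d} {h : interval c d → ℝ}
    (hh : IsBPVRep w g h) : ∀ᵐ t, h.rightLim t / primitive v t = (g t).toReal := by
  filter_upwards [ae_rightLim_eq hh.bpv, hh.ae_eq_mul hw] with t h1 h2
  rw [h1, h2, mul_div_cancel_left₀ _ (hw.primitive_pos t).ne']

lemma IsBPVRep.ae_abs_eq (hw : IsWeight v w) {g : L0 c d} {h : interval c d → ℝ}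
    (hh : IsBPVRep w g h) : ∀ᵐ t, (g t).abs = ‖h.rightLim t / primitive v t‖ₑ := by
  filter_upwards [hh.ae_rightLim_div_eq hw, hh.ae_abs_lt_top hw] with t h1 h2
  rw [h1, EReal.abs_eq_enorm_toReal h2]

lemma IsBPVRep.continuousWithinAt_rightLim_div (hw : IsWeight v w) {g : L0 c d}
    {h : interval c d → ℝ} (hh : IsBPVRep w g h) (x : interval c d) :
    ContinuousWithinAt (fun t => h.rightLim t / primitive v t) (Ici x) x :=
  hh.bpv.continuousWithinAt_rightLim.div hw.continuous_primitive.continuousWithinAt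
    (hw.primitive_pos x).ne'

lemma IsBPVRep.l1Norm_mul_lt_top (hw : IsWeight v w) (hv : ∀ᵐ t, 0 < v t) {g : L0 c d}
    {h : interval c d → ℝ} (hh : IsBPVRep w g h)
    (hS : ∫⁻ t, (v t).toENNReal * tailSup g t < ∞) {f : L0 c d} (hf : f ∈ Ces w) :
    l1Norm (fun x => f x * g x) < ∞ := by
  refine lt_of_le_of_lt (lintegral_mono_ae ?_) (hw.lintegral_abs_mul_tailSup_lt_top hv hS hf)
  filter_upwards [hh.ae_abs_eq hw] with t ht
  rw [EReal.abs_mul]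
  gcongr
  rw [ht]
  exact enorm_le_tailSup (hh.continuousWithinAt_rightLim_div hw) (hh.ae_abs_eq hw) le_rfl

lemma alteredNorm_le_cesNorm (w : interval c d → ℝ) (f : L0 c d) :
    alteredNorm w f ≤ cesNorm w f := by
  refine essSup_mono_ae (ae_of_all _ fun x => ?_)
  dsimp only
  rw [enorm_mul, enorm_mul]
  gcongr
  rw [enorm_le_iff_norm_le]
  refine (norm_integral_le_integral_norm _).trans (le_of_eq_of_le ?_ (le_abs_self _))
  refine integral_congr_ae (ae_of_all _ fun t => ?_)
  dsimp only
  rw [EReal.toReal_coe_ennreal]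
  induction f t with
  | bot => simp
  | top => simp
  | coe y => simp [EReal.abs_def]

/-- Refining the grid turns the discrete integration by parts into the upper bound for the weak
associate norm. The boundary term disappears because the representative of `g / w` tends to `0`. -/
theorem IsWeight.enorm_integral_le (hw : IsWeight v w) (hv : ∀ᵐ t, 0 < v t)
    [Nonempty (interval c d)] {g : L0 c d} (hvg : l1Norm (fun x => v x * g x) < ∞)
    (hS : ∫⁻ t, (v t).toENNReal * tailSup g t < ∞) {h : interval c d → ℝ} (hh : IsBPVRep w g h)
    {f : L0 c d} (hf : f ∈ Ces w) :
    ‖∫ t, (f t * g t).toReal‖ₑ ≤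
      (l1Norm (fun x => v x * g x) + lambdaNorm hh.bpv) * alteredNorm w f := by
  have hvt := hw.toReal_ae_eq hv
  have hfin : alteredNorm w f < ∞ := (alteredNorm_le_cesNorm w f).trans_lt hf.2
  set V := primitive v
  set γ : interval c d → ℝ := fun t => h.rightLim t / V t with hγ
  have hγc := hh.continuousWithinAt_rightLim_div hw
  have hγg : ∀ᵐ t, γ t = (g t).toReal := hh.ae_rightLim_div_eq hw
  have hγabs : ∀ᵐ t, (g t).abs = ‖γ t‖ₑ := hh.ae_abs_eq hw
  have hSfin := hw.tailSup_lt_top hv hS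
  have hγS : ∀ s t, s ≤ t → |γ t| ≤ (tailSup g s).toReal := fun s t hst => by
    have := enorm_le_tailSup hγc hγabs hst
    rw [← Real.norm_eq_abs, ← toReal_enorm]
    exact ENNReal.toReal_mono (hSfin s).ne this
  -- the boundary term at `d`
  have hlim : Tendsto h.rightLim atTop (𝓝 0) := by
    have h1 := hh.bpv.rightLim.tendsto_atTop_limUnder
    have h2 : ∫⁻ t, (v t).toENNReal * ‖h.rightLim t / V t‖ₑ < ∞ := by
      refine lt_of_le_of_lt (le_of_eq (lintegral_congr_ae ?_)) hvg
      filter_upwards [hvt, hγabs] with t h3 h4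
      rw [EReal.abs_mul, h3.2.2.2, h4]
    rwa [hw.eq_zero_of_tendsto hv h1 h2] at h1
  -- the `n`-th grid has mesh `1 / (n + 1)` in `V` and reaches beyond the level `V = n + 1`
  choose! r hr using fun y (hy : (0 : ℝ) < y) => hw.exists_primitive_eq hv hy
  set δ : ℕ → ℝ := fun n => ((n : ℝ) + 1)⁻¹ with hδ
  have hδpos : ∀ n, 0 < δ n := fun n => by positivity
  have hδlim : Tendsto δ atTop (𝓝 0) := tendsto_inv_atTop_zero.comp
    (tendsto_atTop_add_const_right _ _ tendsto_natCast_atTop_atTop)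
  set τ : ℕ → ℕ → interval c d := fun n j => r ((j + 1) * δ n) with hτ
  have hVτ : ∀ n j, V (τ n j) = (j + 1) * δ n := fun n j =>
    hr _ (mul_pos (by positivity) (hδpos n))
  set m : ℕ → ℕ := fun n => (n + 1) ^ 2 with hm
  have hmδ : ∀ n : ℕ, (n : ℝ) + 1 ≤ (m n + 1) * δ n := fun n => by
    have : (0 : ℝ) < n + 1 := by positivity
    simp only [hm, hδ]
    rw [← div_eq_mul_inv, le_div_iff₀ this]
    push_cast; nlinarith
  set step : ℕ → interval c d → ℝ := fun n => gridStep V (δ n) (m n) (fun j => γ (τ n j)) with hstep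
  have hstepm : ∀ n, Measurable (step n) := fun n =>
    measurable_gridStep hw.continuous_primitive.measurable _ _ _
  have hmono := hw.strictMono_primitive hv
  have hstep_le : ∀ n t, |step n t| ≤ (tailSup g t).toReal := by
    intro n t
    obtain ⟨k, _, h2, hk⟩ := exists_gridStep_eq (hδpos n) (hw.primitive_pos t)
    simp only [hstep, V]
    rw [hk]
    split_ifs
    · refine hγS _ _ (hmono.le_iff_le.1 ?_)
      exact h2.trans_eq (hVτ n k).symm
    · simp
  have hstep_lim : ∀ t, Tendsto (fun n => step n t) atTop (𝓝 (γ t)) := by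
    intro t
    choose k h1 h2 hk using fun n => exists_gridStep_eq (hδpos n) (hw.primitive_pos t)
    have h3 : Tendsto (fun n => τ n (k n)) atTop (𝓝[≥] t) := by
      refine tendsto_nhdsWithin_iff.2 ⟨?_, Eventually.of_forall fun n =>
        hmono.le_iff_le.1 ((h2 n).trans_eq (hVτ n _).symm)⟩
      refine tendsto_order.2 ⟨fun b hb => Eventually.of_forall fun n => hb.trans_le
        (hmono.le_iff_le.1 ((h2 n).trans_eq (hVτ n _).symm)), fun b hb => ?_⟩
      have h4 : 0 < V b - V t := sub_pos.2 (hmono hb)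
      filter_upwards [(tendsto_order.1 hδlim).2 _ h4] with n hn
      refine hmono.lt_iff_lt.1 ?_
      have h5 := hVτ n (k n)
      have h6 := h1 n
      simp only [V] at *
      linarith
    refine ((hγc t).tendsto.comp h3).congr' ?_
    filter_upwards [tendsto_natCast_atTop_atTop.eventually (eventually_ge_atTop (V t))] with n hn
    have h4 : k n < m n + 1 := by
      have h5 : (k n : ℝ) * δ n < (m n + 1) * δ n := by
        have := hmδ n
        have := h1 n
        simp only [V] at *
        linarith
      exact_mod_cast lt_of_mul_lt_mul_right h5 (hδpos n).le
    simp only [hstep, V, Function.comp]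
    rw [hk, if_pos h4]
  have hfm : Measurable fun t => (f t).toReal := measurable_ereal_toReal.comp f.measurable
  have hvm : AEMeasurable fun t => (v t).toReal :=
    measurable_ereal_toReal.comp_aemeasurable hw.aemeasurable
  have hSm : Measurable fun t => (tailSup g t).toReal :=
    (antitone_tailSup g).measurable.ennreal_toReal
  have hdom : ∀ {φ : interval c d → ℝ} {ψ : interval c d → ℝ≥0∞}, AEMeasurable φ →
      (∀ᵐ t, ‖φ t‖ₑ ≤ ψ t) → ∫⁻ t, ψ t * tailSup g t < ∞ →
      Integrable fun t => |φ t| * (tailSup g t).toReal := by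
    intro φ ψ hφ hφψ hfi
    refine ⟨(hφ.abs.mul hSm.aemeasurable).aestronglyMeasurable, ?_⟩
    rw [hasFiniteIntegral_iff_enorm]
    refine lt_of_le_of_lt (lintegral_mono_ae ?_) hfi
    filter_upwards [hφψ] with t ht
    rw [enorm_mul, Real.enorm_abs, Real.enorm_toReal (hSfin t).ne]
    gcongr
  have hdf := hdom hfm.aemeasurable (ae_of_all _ fun t => EReal.enorm_toReal_le_abs (f t))
    (hw.lintegral_abs_mul_tailSup_lt_top hv hS hf)
  have hdv := hdom hvm (ψ := fun t => (v t).toENNReal) (hvt.mono fun t ht => by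
    rw [← ofReal_norm, Real.norm_eq_abs, abs_of_pos ht.1, ht.2.2.1]) hS
  have hL : Tendsto (fun n => ∫ t, (f t).toReal * step n t) atTop
      (𝓝 (∫ t, (f t).toReal * γ t)) := by
    refine tendsto_integral_of_dominated_convergence _
      (fun n => (hfm.mul (hstepm n)).aestronglyMeasurable) hdf (fun n => ae_of_all _ fun t => ?_)
      (ae_of_all _ fun t => (hstep_lim t).const_mul _)
    rw [Real.norm_eq_abs, abs_mul]
    exact mul_le_mul_of_nonneg_left (hstep_le n t) (abs_nonneg _)
  have hR : Tendsto (fun n => ∫ t, (v t).toReal * |step n t|) atTop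
      (𝓝 (∫ t, (v t).toReal * |γ t|)) := by
    refine tendsto_integral_of_dominated_convergence _
      (fun n => (hvm.mul (hstepm n).aemeasurable.abs).aestronglyMeasurable) hdv
      (fun n => ae_of_all _ fun t => ?_)
      (ae_of_all _ fun t => (hstep_lim t).abs.const_mul _)
    rw [Real.norm_eq_abs, abs_mul, abs_abs]
    exact mul_le_mul_of_nonneg_left (hstep_le n t) (abs_nonneg _)
  have hB : Tendsto (fun n => |h.rightLim (τ n (m n))|) atTop (𝓝 0) := by
    have h1 : Tendsto (fun n => τ n (m n)) atTop atTop := by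
      refine tendsto_atTop.2 fun b => ?_
      filter_upwards [tendsto_natCast_atTop_atTop.eventually (eventually_ge_atTop (V b))] with n hn
      refine hmono.le_iff_le.1 ?_
      have h2 := hVτ n (m n)
      have h3 := hmδ n
      simp only [V] at *
      linarith
    simpa using (hlim.comp h1).abs
  have hlam := lambdaNorm_ne_top hh.bpv
  have hfinal : |∫ t, (f t).toReal * γ t| ≤ (alteredNorm w f).toReal *
      ((lambdaNorm hh.bpv).toReal + 0 + ∫ t, (v t).toReal * |γ t|) :=
    le_of_tendsto_of_tendsto' hL.abs (((hB.const_add _).add hR).const_mul _) fun n =>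
      hw.abs_integral_mul_gridStep_le hv hf.1 hfin hh.bpv (hδpos n) (hVτ n) (m n)
  have h1 : ∫ t, (f t).toReal * γ t = ∫ t, (f t * g t).toReal :=
    integral_congr_ae (hγg.mono fun t ht => by dsimp only; rw [ht, EReal.toReal_mul])
  have h2 : ∫ t, (v t).toReal * |γ t| = (l1Norm (fun x => v x * g x)).toReal := by
    rw [integral_eq_lintegral_of_nonneg_ae (hvt.mono fun t ht => mul_nonneg ht.1.le (abs_nonneg _))
      ((hvm.mul (aemeasurable_congr (hγg.mono fun t ht => ht)
        |>.2 (measurable_ereal_toReal.comp g.measurable).aemeasurable).abs).aestronglyMeasurable)]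
    congr 1
    refine lintegral_congr_ae ?_
    filter_upwards [hvt, hγabs] with t h3 h4
    rw [EReal.abs_mul, h3.2.2.2, h4, ENNReal.ofReal_mul h3.1.le, h3.2.2.1, ← Real.norm_eq_abs,
      ofReal_norm]
  rw [h1, h2, add_zero, ← ENNReal.toReal_add hlam hvg.ne, ← ENNReal.toReal_mul] at hfinal
  rw [← ofReal_norm, Real.norm_eq_abs, mul_comm, add_comm (l1Norm _)]
  exact ENNReal.ofReal_le_of_le_toReal hfinal

theorem IsWeight.weakAssociateNorm_le (hw : IsWeight v w) (hv : ∀ᵐ t, 0 < v t)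
    [Nonempty (interval c d)] {g : L0 c d} (hvg : l1Norm (fun x => v x * g x) < ∞)
    (hS : ∫⁻ t, (v t).toENNReal * tailSup g t < ∞) {h : interval c d → ℝ}
    (hh : IsBPVRep w g h) :
    weakAssociateNorm (Ces w) (alteredNorm w) g ≤
      l1Norm (fun x => v x * g x) + lambdaNorm hh.bpv :=
  iSup_le fun _ => iSup₂_le fun hf _ =>
    ENNReal.div_le_of_le_mul (hw.enorm_integral_le hv hvg hS hh hf)

end UpperBound

end CesaroSpace

end

theorem mainTheorem5 :
    ∃ A B : ℝ≥0, 0 < A ∧ 0 < B ∧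
      ∀ (c d : EReal), c < d →
      ∀ (v : CesaroSpace.interval c d → EReal) (w : CesaroSpace.interval c d → ℝ),
        CesaroSpace.IsWeight v w → (∀ᵐ t, 0 < v t) →
      ∀ g : CesaroSpace.L0 c d,
        (g ∈ CesaroSpace.weakAssociate (CesaroSpace.Ces w) (CesaroSpace.alteredNorm w) ↔
          CesaroSpace.l1Norm (fun x => v x * g x) < ∞ ∧
          (∃ h : CesaroSpace.interval c d → ℝ, CesaroSpace.IsBPVRep w g h) ∧
          ∫⁻ t, (v t).toENNReal * essSup (fun x => (g x).abs) (volume.restrict (Ici t)) < ∞) ∧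
        (g ∈ CesaroSpace.weakAssociate (CesaroSpace.Ces w) (CesaroSpace.alteredNorm w) →
          ∀ (h : CesaroSpace.interval c d → ℝ) (hh : CesaroSpace.IsBPVRep w g h),
            (A : ℝ≥0∞) * (CesaroSpace.l1Norm (fun x => v x * g x) +
                CesaroSpace.lambdaNorm hh.bpv) ≤
              CesaroSpace.weakAssociateNorm (CesaroSpace.Ces w) (CesaroSpace.alteredNorm w) g ∧
            CesaroSpace.weakAssociateNorm (CesaroSpace.Ces w) (CesaroSpace.alteredNorm w) g ≤
              (B : ℝ≥0∞) * (CesaroSpace.l1Norm (fun x => v x * g x) +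
                CesaroSpace.lambdaNorm hh.bpv)) := by
  refine ⟨3⁻¹, 1, by positivity, one_pos, fun c d hcd v w hw hv g => ?_⟩
  have := CesaroSpace.nonempty_interval hcd
  have hiff : g ∈ CesaroSpace.weakAssociate (CesaroSpace.Ces w) (CesaroSpace.alteredNorm w) ↔
      CesaroSpace.l1Norm (fun x => v x * g x) < ∞ ∧
      (∃ h : CesaroSpace.interval c d → ℝ, CesaroSpace.IsBPVRep w g h) ∧
      ∫⁻ t, (v t).toENNReal * CesaroSpace.tailSup g t < ∞ := by
    constructor
    · intro hg
      obtain ⟨hfin, h1, ⟨E, hE, hvar⟩, h3⟩ := hw.bounds_of_mem_weakAssociate hv hg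
      refine ⟨h1.trans_lt hg.2, hw.exists_isBPVRep hfin hE ?_, h3.trans_lt hg.2⟩
      exact (hvar.trans_lt (ENNReal.mul_lt_top ENNReal.ofNat_lt_top hg.2)).ne
    · rintro ⟨h1, ⟨h, hh⟩, h3⟩
      refine ⟨fun f hf => hh.l1Norm_mul_lt_top hw hv h3 hf, ?_⟩
      exact (hw.weakAssociateNorm_le hv h1 h3 hh).trans_lt
        (ENNReal.add_lt_top.2 ⟨h1, (CesaroSpace.lambdaNorm_ne_top hh.bpv).lt_top⟩)
  refine ⟨hiff, fun hg h hh => ⟨?_, ?_⟩⟩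
  · obtain ⟨-, h1, ⟨E, hE, hvar⟩, -⟩ := hw.bounds_of_mem_weakAssociate hv hg
    rw [ENNReal.coe_inv three_ne_zero, ENNReal.inv_mul_le_iff (by simp) (by simp)]
    refine (add_le_add h1 ((hh.lambdaNorm_le hw hE).trans hvar)).trans (le_of_eq ?_)
    push_cast
    ring
  · obtain ⟨h1, -, h3⟩ := hiff.1 hg
    rw [ENNReal.coe_one, one_mul]
    exact hw.weakAssociateNorm_le hv h1 h3 hh
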